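/- Let $\Gamma$ be a finite group, $k$ a field whose characteristic does not divide $|\Gamma|$, and $G$ an affine algebraic group over $k$ with a homomorphism $\rho\colon\Gamma\to\operatorname{Aut}(G)$, $\gamma\mapsto\gamma_G$. Let $\pi\colon\tilde X\to X$ be a (possibly ramified) $\Gamma$-covering of $k$-schemes: $\pi$ is finite and flat, $\Gamma$ is identified with the group of automorphisms $\gamma_{\tilde X}$ of $\tilde X$ over $X$, and over a dense open subscheme of $X$ the scheme $\tilde X$ is an étale $\Gamma$-torsor. For a $k$-scheme $T$, a $(\Gamma,G)$-bundle on $\tilde X\times T$ is a right $G$-torsor $\mathcal Q$ (for the étale topology) on $\tilde X\times T$ with a left action of $\Gamma$ on its total space lifting the action on $\tilde X\times T$ (trivial on $T$) and such that $\gamma(qg)=\gamma(q)\gamma_G(g)$. Two $(\Gamma,G)$-bundles $\mathcal Q_1,\mathcal Q_2$ on $\tilde X\times T$ have the same local type if for every geometric point $x$ of $X\times T$ there is a $\Gamma$-invariant isomorphism of $G$-bundles between their pullbacks to the fibre of $\tilde X\times T\to X\times T$ over $x$. Fix a $(\Gamma,G)$-bundle $\mathcal P$ on $\tilde X$, and let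 $\mathcal H_{\mathcal P}=(\pi_*\mathscr{I}\!so_G(\mathcal P,\mathcal P))^\Gamma$ be the group over $X$ of $\Gamma$-invariants in the Weil restriction of the group of automorphisms of the $G$-bundle $\mathcal P$, where $\gamma$ acts by $\phi\mapsto\gamma_{\mathcal P}\circ\phi\circ\gamma_{\mathcal P}^{-1}$; by adjunction $\pi^*\mathcal H_{\mathcal P}$ acts on $\mathcal P$ on the left. Let $\mathcal Bun_{\mathcal H_{\mathcal P}}$ be the stack over $k$ whose objects over $T$ are the $\mathcal H_{\mathcal P}$-torsors (for the étale topology) on $X\times T$, and $\mathcal Bun^{\mathcal P}_{(\Gamma,G)}$ the stack whose objects over $T$ are the $(\Gamma,G)$-bundles on $\tilde X\times T$ with the same local type as the pullback $\mathcal P_T$ of $\mathcal P$ to $\tilde X\times T$. Then for every $T$ and every $\mathcal H_{\mathcal P}$-torsor $\mathcal F$ on $X\times T$, the contracted product $\pi^*\mathcal F\times^{\pi^*\mathcal H_{\mathcal P}}\mathcal P_T$ (the étale sheaf quotient of $\pi^*\mathcal F\times_{\tilde X\times T}\mathcal P_T$ by $(fh,p)\sim(f,hp)$), with the actions $[f,p]g=[f,pg]$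 and $\gamma[f,p]=[f,\gamma_{\mathcal P}(p)]$, is a $(\Gamma,G)$-bundle on $\tilde X\times T$ with the same local type as $\mathcal P_T$; and $\mathcal F\mapsto\pi^*\mathcal F\times^{\pi^*\mathcal H_{\mathcal P}}\mathcal P_T$, with $[f,p]\mapsto[u(f),p]$ on morphisms $u$, defines a morphism of stacks $\mathcal Bun_{\mathcal H_{\mathcal P}}\to\mathcal Bun^{\mathcal P}_{(\Gamma,G)}$. -/

import Mathlib

open CategoryTheory Limits MonoidalCategory CartesianMonoidalCategory Opposite AlgebraicGeometry
open scoped MonObj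

universe u v

noncomputable section

namespace GammaBundle

/-! ### The big étale site of a field -/

/-- The category of schemes over the field `k`. -/
abbrev Sch (k : Type u) [Field k] : Type (u + 1) := Over (Spec (CommRingCat.of k))

/-- The (big) étale topology on `k`-schemes. -/
abbrev etaleSite (k : Type u) [Field k] : GrothendieckTopology (Sch k) :=
  Scheme.etaleTopology.over (Spec (CommRingCat.of k))

/-- Étale sheaves (of possibly large sets) on the category of `k`-schemes. -/
abbrev EtSheaf (k : Type u) [Field k] := Sheaf (etaleSite k) (Type (u + 1))

section Sections

variable {k : Type u} [Field k]

/-- The `S`-valued points of an étale sheaf. -/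
abbrev EtSheaf.Sec (F : EtSheaf k) (S : Sch k) : Type (u + 1) := F.obj.obj (op S)

/-- Restriction of an `S`-valued point along `a : S' ⟶ S`. -/
def EtSheaf.res (F : EtSheaf k) {S S' : Sch k} (a : S' ⟶ S) (x : F.Sec S) : F.Sec S' :=
  F.obj.map a.op x

lemma EtSheaf.res_id (F : EtSheaf k) {S : Sch k} (x : F.Sec S) : F.res (𝟙 S) x = x := by
  simp [EtSheaf.res]

lemma EtSheaf.res_comp (F : EtSheaf k) {S S' S'' : Sch k} (a : S' ⟶ S) (b : S'' ⟶ S')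
    (x : F.Sec S) : F.res (b ≫ a) x = F.res b (F.res a x) := by
  simp [EtSheaf.res]

/-- The effect of a morphism of étale sheaves on `S`-valued points. -/
def EtSheaf.ap {F F' : EtSheaf k} (u : F ⟶ F') {S : Sch k} (x : F.Sec S) : F'.Sec S :=
  u.hom.app (op S) x

lemma EtSheaf.ap_res {F F' : EtSheaf k} (u : F ⟶ F') {S S' : Sch k} (a : S' ⟶ S) (x : F.Sec S) :
    EtSheaf.ap u (F.res a x) = F'.res a (EtSheaf.ap u x) :=
  NatTrans.naturality_apply u.hom a.op x

instance etaleSite_subcanonical : (etaleSite k).Subcanonical := by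
  have h : Scheme.etaleTopology.{u} ≤ Scheme.fppfTopology := by
    apply Scheme.grothendieckTopology_monotone
    intro X Y f hf
    constructor <;> infer_instance
  have : Scheme.etaleTopology.{u}.Subcanonical := GrothendieckTopology.Subcanonical.of_le h
  infer_instance

/-- The étale sheaf `F × T`, for an étale sheaf `F` and a `k`-scheme `T`. -/
def EtSheaf.prod (F : EtSheaf k) (T : Sch k) : EtSheaf k where
  obj :=
    { obj := fun S => F.Sec S.unop × (S.unop ⟶ T)
      map := fun a => ↾fun x => (F.res a.unop x.1, a.unop ≫ x.2)
      map_id := fun S => by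
        ext x
        · simp [EtSheaf.res]
        · simp
      map_comp := fun a b => by
        ext x
        · simp [EtSheaf.res]
        · simp }
  property := by
    rw [isSheaf_iff_isSheaf_of_type]
    intro S R hR x hx
    have h1 := (isSheaf_iff_isSheaf_of_type _ _).1 F.property R hR
    have h2 := GrothendieckTopology.Subcanonical.isSheaf_of_isRepresentable
      (J := etaleSite k) (yoneda.obj T) R hR
    have c1 : Presieve.FamilyOfElements.Compatible
        (P := F.obj) (R := R.arrows) (fun Y f hf => (x f hf).1) := by
      intro Y₁ Y₂ Z g₁ g₂ f₁ f₂ k₁ k₂ e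
      exact congrArg Prod.fst (hx g₁ g₂ k₁ k₂ e)
    have c2 : Presieve.FamilyOfElements.Compatible
        (P := yoneda.obj T) (R := R.arrows) (fun Y f hf => (x f hf).2) := by
      intro Y₁ Y₂ Z g₁ g₂ f₁ f₂ k₁ k₂ e
      exact congrArg Prod.snd (hx g₁ g₂ k₁ k₂ e)
    obtain ⟨t1, ht1, u1⟩ := h1 _ c1
    obtain ⟨t2, ht2, u2⟩ := h2 _ c2
    refine ⟨(t1, t2), fun Y f hf => Prod.ext (ht1 f hf) (ht2 f hf), fun y hy => ?_⟩
    exact Prod.ext (u1 _ fun Y f hf => congrArg Prod.fst (hy f hf))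
      (u2 _ fun Y f hf => congrArg Prod.snd (hy f hf))

end Sections

/-! ### Coverings -/

/-- A morphism `total ⟶ base` of `k`-schemes with an action of the abstract group `Γ` on `total`
by automorphisms over `base`.  (As `Aut` is a group under composition of maps, `act` is a left
action.) -/
structure EquivMap (k : Type u) [Field k] (Γ : Type v) [Group Γ] where
  total : Sch k
  base : Sch k
  map : total ⟶ base
  act : Γ →* Aut total
  act_map : ∀ σ, (act σ).hom ≫ map = map

namespace EquivMap

variable {k : Type u} [Field k] {Γ : Type v} [Group Γ]

/-- The morphism `Γ × X̃ ⟶ X̃ ×_X X̃`, `(σ, x) ↦ (σ x, x)`, of schemes. -/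
def actionMap [Finite Γ] (C : EquivMap k Γ) :
    (∐ fun _ : Γ => C.total.left) ⟶ pullback C.map.left C.map.left :=
  Sigma.desc fun σ => pullback.lift (C.act σ).hom.left (𝟙 _)
    (by rw [← Over.comp_left, C.act_map, Category.id_comp])

/-- A (possibly ramified) `Γ`-covering: a finite flat morphism `π : X̃ ⟶ X` such that `Γ` is, via
its action, the group of automorphisms of `X̃` over `X`, and such that over some dense open `U` of
`X` the scheme `X̃` is an étale `Γ`-torsor. -/
structure IsRamifiedCovering [Finite Γ] (C : EquivMap k Γ) : Prop where
  finite : IsFinite C.map.left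
  flat : Flat C.map.left
  aut : ∀ τ : Aut C.total, τ.hom ≫ C.map = C.map → ∃! σ : Γ, C.act σ = τ
  generically_torsor : ∃ U : C.base.left.Opens, Dense (U : Set C.base.left) ∧
    Etale (C.map.left ∣_ U) ∧ Surjective (C.map.left ∣_ U) ∧
    IsIso (C.actionMap ∣_
      ((pullback.fst C.map.left C.map.left ≫ C.map.left) ⁻¹ᵁ U))

/-- The base change `X̃ × T ⟶ X × T` to a `k`-scheme `T`, `Γ` acting on the first factor. -/
def prod (C : EquivMap k Γ) (T : Sch k) : EquivMap k Γ where
  total := C.total ⊗ T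
  base := C.base ⊗ T
  map := C.map ▷ T
  act := ((tensorRight T).mapAut C.total).comp C.act
  act_map σ := by
    change (C.act σ).hom ▷ T ≫ C.map ▷ T = C.map ▷ T
    rw [← comp_whiskerRight, C.act_map]

end EquivMap

/-! ### `(Γ, G)`-bundles -/

section Bundles

variable {k : Type u} [Field k] {Γ : Type v} [Group Γ]

/-- Given a left action `ρ` of `Γ` on the group scheme `G` by group automorphisms, a
`(Γ, G)`-bundle on `X̃` is a right `G`-torsor for the étale topology on `X̃`, with a left action of
`Γ` on its total space that lifts the action on `X̃` and satisfies `σ (p g) = σ (p) σ (g)`.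

The total space is given through its functor of points, an étale sheaf on `k`-schemes with a map
to `X̃`. -/
structure GBundle {G : Grp (Sch k)} (ρ : Γ →* Aut G) (C : EquivMap k Γ) where
  /-- the total space -/
  sheaf : EtSheaf k
  /-- the projection to `X̃` -/
  proj : ∀ {S : Sch k}, sheaf.Sec S → (S ⟶ C.total)
  proj_res : ∀ {S S' : Sch k} (a : S' ⟶ S) (p : sheaf.Sec S), proj (sheaf.res a p) = a ≫ proj p
  /-- the right action of `G` -/
  smul : ∀ {S : Sch k}, sheaf.Sec S → (S ⟶ G.X) → sheaf.Sec S
  smul_one : ∀ {S : Sch k} (p : sheaf.Sec S), smul p 1 = p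
  smul_mul : ∀ {S : Sch k} (p : sheaf.Sec S) (g g' : S ⟶ G.X),
    smul p (g * g') = smul (smul p g) g'
  smul_res : ∀ {S S' : Sch k} (a : S' ⟶ S) (p : sheaf.Sec S) (g : S ⟶ G.X),
    sheaf.res a (smul p g) = smul (sheaf.res a p) (a ≫ g)
  proj_smul : ∀ {S : Sch k} (p : sheaf.Sec S) (g : S ⟶ G.X), proj (smul p g) = proj p
  simply_transitive : ∀ {S : Sch k} (p p' : sheaf.Sec S), proj p = proj p' → ∃! g, smul p g = p'
  locally_nonempty : ∀ {S : Sch k} (y : S ⟶ C.total), ∃ R ∈ etaleSite k S,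
    ∀ {S' : Sch k} (a : S' ⟶ S), R.arrows a → ∃ p : sheaf.Sec S', proj p = a ≫ y
  /-- the left action of `Γ` -/
  gsmul : ∀ {S : Sch k}, Γ → sheaf.Sec S → sheaf.Sec S
  gsmul_one : ∀ {S : Sch k} (p : sheaf.Sec S), gsmul 1 p = p
  gsmul_mul : ∀ {S : Sch k} (σ τ : Γ) (p : sheaf.Sec S), gsmul (σ * τ) p = gsmul σ (gsmul τ p)
  gsmul_res : ∀ {S S' : Sch k} (a : S' ⟶ S) (σ : Γ) (p : sheaf.Sec S),
    sheaf.res a (gsmul σ p) = gsmul σ (sheaf.res a p)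
  proj_gsmul : ∀ {S : Sch k} (σ : Γ) (p : sheaf.Sec S), proj (gsmul σ p) = proj p ≫ (C.act σ).hom
  gsmul_smul : ∀ {S : Sch k} (σ : Γ) (p : sheaf.Sec S) (g : S ⟶ G.X),
    gsmul σ (smul p g) = smul (gsmul σ p) (g ≫ (ρ σ).hom.hom.hom)

variable {G : Grp (Sch k)} {ρ : Γ →* Aut G} {C : EquivMap k Γ}

namespace GBundle

/-- The points of the bundle lying over a given point `y` of `X̃`. -/
def Fib (P : GBundle ρ C) {S : Sch k} (y : S ⟶ C.total) : Type (u + 1) :=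
  {p : P.sheaf.Sec S // P.proj p = y}

/-- Restriction of points of the fibres. -/
def Fib.res {P : GBundle ρ C} {S S' : Sch k} (a : S' ⟶ S) {y : S ⟶ C.total} (p : P.Fib y) :
    P.Fib (a ≫ y) :=
  ⟨P.sheaf.res a p.1, by rw [P.proj_res, p.2]⟩

/-- The `G`-action on the fibres. -/
def Fib.smul {P : GBundle ρ C} {S : Sch k} {y : S ⟶ C.total} (p : P.Fib y) (g : S ⟶ G.X) :
    P.Fib y :=
  ⟨P.smul p.1 g, by rw [P.proj_smul, p.2]⟩

/-- The action of `σ : Γ` carries the fibre at `y` to the fibre at `σ y`. -/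
def Fib.gsmul {P : GBundle ρ C} {S : Sch k} {y : S ⟶ C.total} (σ : Γ) (p : P.Fib y) :
    P.Fib (y ≫ (C.act σ).hom) :=
  ⟨P.gsmul σ p.1, by rw [P.proj_gsmul, p.2]⟩

/-- The base change of a `(Γ, G)`-bundle on `X̃` to a `(Γ, G)`-bundle on `X̃ × T`; its total space
is `P × T`. -/
def prod (P : GBundle ρ C) (T : Sch k) : GBundle ρ (C.prod T) where
  sheaf := P.sheaf.prod T
  proj x := lift (P.proj x.1) x.2
  proj_res a x := by
    change lift (P.proj (P.sheaf.res a x.1)) (a ≫ x.2) = _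
    rw [P.proj_res]
    exact (comp_lift _ _ _).symm
  smul x g := (P.smul x.1 g, x.2)
  smul_one x := Prod.ext (P.smul_one x.1) rfl
  smul_mul x g g' := Prod.ext (P.smul_mul x.1 g g') rfl
  smul_res a x g := Prod.ext (P.smul_res a x.1 g) rfl
  proj_smul x g := by
    change lift (P.proj (P.smul x.1 g)) x.2 = _
    rw [P.proj_smul]
  simply_transitive x x' h := by
    have h1 : P.proj x.1 = P.proj x'.1 := by simpa using congrArg (· ≫ fst _ _) h
    have h2 : x.2 = x'.2 := by simpa using congrArg (· ≫ snd _ _) h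
    obtain ⟨g, hg, hu⟩ := P.simply_transitive x.1 x'.1 h1
    exact ⟨g, Prod.ext hg h2, fun g' hg' => hu g' (congrArg Prod.fst hg')⟩
  locally_nonempty {S} y := by
    change S ⟶ C.total ⊗ T at y
    obtain ⟨R, hR, h⟩ := P.locally_nonempty (y ≫ fst C.total T)
    refine ⟨R, hR, fun {S'} a ha => ?_⟩
    obtain ⟨p, hp⟩ := h a ha
    have e : lift (P.proj p) (a ≫ y ≫ snd C.total T) = a ≫ y := by
      rw [hp, ← comp_lift, ← comp_lift, lift_fst_snd, Category.comp_id]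
    exact ⟨(p, a ≫ y ≫ snd C.total T), e⟩
  gsmul σ x := (P.gsmul σ x.1, x.2)
  gsmul_one x := Prod.ext (P.gsmul_one x.1) rfl
  gsmul_mul σ τ x := Prod.ext (P.gsmul_mul σ τ x.1) rfl
  gsmul_res a σ x := Prod.ext (P.gsmul_res a σ x.1) rfl
  proj_gsmul σ x := by
    change lift (P.proj (P.gsmul σ x.1)) x.2 = lift (P.proj x.1) x.2 ≫ (C.act σ).hom ▷ T
    rw [P.proj_gsmul, lift_whiskerRight]
  gsmul_smul σ x g := Prod.ext (P.gsmul_smul σ x.1 g) rfl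

end GBundle

/-! ### The group scheme `H_P`, and local types -/

/-- The points over `s : S ⟶ X` of the Weil restriction `π_* Iso_G(P, Q)` along `π : X̃ ⟶ X`, for
`(Γ, G)`-bundles `P`, `Q` on `X̃`: these are the sections of `Iso_G(P, Q)` over `S ×_X X̃`, i.e. the
isomorphisms of `G`-bundles between the pullbacks of `P` and `Q` to `S ×_X X̃`.

An `S'`-point of `S ×_X X̃` is a pair `(a, y)` of points of `S` and `X̃` with the same image in `X`,
and the fibre at this point of the pullback of `P` is the fibre of `P` at `y`. -/
@[ext]
structure WeilIso (P Q : GBundle ρ C) {S : Sch k} (s : S ⟶ C.base) where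
  toEquiv : ∀ {S' : Sch k} (a : S' ⟶ S) (y : S' ⟶ C.total), a ≫ s = y ≫ C.map → P.Fib y ≃ Q.Fib y
  natural : ∀ {S' S'' : Sch k} (b : S'' ⟶ S') (a : S' ⟶ S) (y : S' ⟶ C.total)
    (h : a ≫ s = y ≫ C.map) (h' : (b ≫ a) ≫ s = (b ≫ y) ≫ C.map) (p : P.Fib y),
    toEquiv (b ≫ a) (b ≫ y) h' (p.res b) = (toEquiv a y h p).res b
  equivariant : ∀ {S' : Sch k} (a : S' ⟶ S) (y : S' ⟶ C.total) (h : a ≫ s = y ≫ C.map)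
    (p : P.Fib y) (g : S' ⟶ G.X), toEquiv a y h (p.smul g) = (toEquiv a y h p).smul g

namespace WeilIso

/-- `φ` is fixed by the action `φ ↦ σ_Q ∘ φ ∘ σ_P⁻¹` of `Γ` on the points of `π_* Iso_G(P, Q)`
(which covers the action of `Γ` on `S ×_X X̃`), that is, `φ` commutes with the actions of `Γ`. -/
def IsInvariant {P Q : GBundle ρ C} {S : Sch k} {s : S ⟶ C.base} (φ : WeilIso P Q s) : Prop :=
  ∀ (σ : Γ) {S' : Sch k} (a : S' ⟶ S) (y : S' ⟶ C.total) (h : a ≫ s = y ≫ C.map)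
    (h' : a ≫ s = (y ≫ (C.act σ).hom) ≫ C.map) (p : P.Fib y),
    φ.toEquiv a (y ≫ (C.act σ).hom) h' (p.gsmul σ) = (φ.toEquiv a y h p).gsmul σ

end WeilIso

/-- `P` and `Q` have the same local type at the geometric point `x` of `X`: there is a
`Γ`-invariant isomorphism of `G`-bundles between their pullbacks to `π⁻¹{x}`. -/
def SameLocalTypeAt (P Q : GBundle ρ C) {S : Sch k} (x : S ⟶ C.base) : Prop :=
  ∃ φ : WeilIso P Q x, φ.IsInvariant

/-- `P` and `Q` have the same local type, i.e. they have the same local type at every geometric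
point of `X`. -/
def SameLocalType (P Q : GBundle ρ C) : Prop :=
  ∀ (Ω : Type u) [Field Ω] [IsAlgClosed Ω] (x : Spec (CommRingCat.of Ω) ⟶ C.base.left),
    SameLocalTypeAt P Q (Over.homMk (U := Over.mk (x ≫ C.base.hom)) (V := C.base) x)

/-- The group functor `H_P = (π_* Iso_G(P, P))^Γ` over `X`: its points over `s : S ⟶ X`. -/
def HP (P : GBundle ρ C) {S : Sch k} (s : S ⟶ C.base) : Type (u + 1) :=
  {φ : WeilIso P P s // φ.IsInvariant}

namespace HP

variable {P : GBundle ρ C} {S : Sch k} {s : S ⟶ C.base}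

lemma ext' {φ ψ : HP P s} (h : ∀ {S' : Sch k} (a : S' ⟶ S) (y : S' ⟶ C.total)
    (e : a ≫ s = y ≫ C.map) (p : P.Fib y), φ.1.toEquiv a y e p = ψ.1.toEquiv a y e p) : φ = ψ := by
  apply Subtype.ext
  apply WeilIso.ext
  funext S' a y e
  exact Equiv.ext (h a y e)

instance : One (HP P s) where
  one := ⟨{ toEquiv := fun _ _ _ => Equiv.refl _
            natural := fun _ _ _ _ _ _ => rfl
            equivariant := fun _ _ _ _ _ => rfl }, fun _ _ _ _ _ _ _ => rfl⟩

/-- The product is composition: `(φ * ψ)(p) = φ (ψ p)`. -/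
instance : Mul (HP P s) where
  mul φ ψ :=
    ⟨{ toEquiv := fun a y h => (ψ.1.toEquiv a y h).trans (φ.1.toEquiv a y h)
       natural := fun b a y h h' p => by
        simp only [Equiv.trans_apply]
        rw [ψ.1.natural b a y h h', φ.1.natural b a y h h']
       equivariant := fun a y h p g => by
        simp only [Equiv.trans_apply]
        rw [ψ.1.equivariant, φ.1.equivariant] },
      fun σ S' a y h h' p => by
        simp only [Equiv.trans_apply]
        rw [ψ.2 σ a y h h', φ.2 σ a y h h']⟩

instance : Inv (HP P s) where
  inv φ :=
    ⟨{ toEquiv := fun a y h => (φ.1.toEquiv a y h).symm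
       natural := fun b a y h h' p => by
        rw [Equiv.symm_apply_eq, φ.1.natural b a y h h', Equiv.apply_symm_apply]
       equivariant := fun a y h p g => by
        rw [Equiv.symm_apply_eq, φ.1.equivariant, Equiv.apply_symm_apply] },
      fun σ S' a y h h' p => by
        rw [Equiv.symm_apply_eq, φ.2 σ a y h h', Equiv.apply_symm_apply]⟩

instance : Group (HP P s) where
  mul_assoc _ _ _ := rfl
  one_mul _ := rfl
  mul_one _ := rfl
  inv_mul_cancel φ := ext' fun a y e p => (φ.1.toEquiv a y e).symm_apply_apply p

/-- Restriction of points of `H_P` along `b : S' ⟶ S`. -/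
def res {S' : Sch k} (b : S' ⟶ S) (φ : HP P s) : HP P (b ≫ s) :=
  ⟨{ toEquiv := fun a y h => φ.1.toEquiv (a ≫ b) y (by rw [Category.assoc, h])
     natural := fun b' a y h h' p => by
      have := φ.1.natural b' (a ≫ b) y (by rw [Category.assoc, h])
        (by rw [Category.assoc, Category.assoc, h, Category.assoc]) p
      simpa only [Category.assoc] using this
     equivariant := fun a y h p g => φ.1.equivariant (a ≫ b) y _ p g },
    fun σ S' a y h h' p => φ.2 σ (a ≫ b) y _ _ p⟩

/-- The left action of `π^* H_P` on `P`: the value at a point `p` of `P` of a point `φ` of `H_P`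
with the same image `s` in `X`. -/
def smul (φ : HP P s) (p : P.sheaf.Sec S) (h : P.proj p ≫ C.map = s) : P.sheaf.Sec S :=
  (φ.1.toEquiv (𝟙 S) (P.proj p) (by rw [Category.id_comp, h]) ⟨p, rfl⟩).1

lemma proj_smul (φ : HP P s) (p : P.sheaf.Sec S) (h : P.proj p ≫ C.map = s) :
    P.proj (φ.smul p h) = P.proj p :=
  (φ.1.toEquiv (𝟙 S) (P.proj p) (by rw [Category.id_comp, h]) ⟨p, rfl⟩).2

lemma res_smul {S' : Sch k} (b : S' ⟶ S) (φ : HP P s) (p : P.sheaf.Sec S)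
    (h : P.proj p ≫ C.map = s) (h' : P.proj (P.sheaf.res b p) ≫ C.map = b ≫ s) :
    P.sheaf.res b (φ.smul p h) = (φ.res b).smul (P.sheaf.res b p) h' := by
  have key : ∀ (a a' : S' ⟶ S) (y y' : S' ⟶ C.total) (e : a ≫ s = y ≫ C.map)
      (e' : a' ≫ s = y' ≫ C.map) (q : P.Fib y) (q' : P.Fib y'), a = a' → q.1 = q'.1 →
      (φ.1.toEquiv a y e q).1 = (φ.1.toEquiv a' y' e' q').1 := by
    rintro a _ y y' e e' q q' rfl hq
    obtain rfl : y = y' := by rw [← q.2, ← q'.2, hq]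
    obtain rfl : q = q' := Subtype.ext hq
    rfl
  have := congrArg Subtype.val (φ.1.natural b (𝟙 S) (P.proj p) (by rw [Category.id_comp, h])
    (by rw [Category.comp_id, Category.assoc, h]) ⟨p, rfl⟩)
  exact this.symm.trans (key _ _ _ _ _ _ _ _ (by simp) rfl)

end HP

/-! ### `H_P`-bundles and the contracted product -/

/-- An `H_P`-bundle on `X × T`: a right torsor, for the étale topology on `X × T`, under (the
pullback to `X × T` of) the group `H_P` over `X`. -/
structure HBundle (P : GBundle ρ C) (T : Sch k) where
  /-- the total space -/
  sheaf : EtSheaf k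
  /-- the projection to `X × T` -/
  proj : ∀ {S : Sch k}, sheaf.Sec S → (S ⟶ C.base ⊗ T)
  proj_res : ∀ {S S' : Sch k} (a : S' ⟶ S) (f : sheaf.Sec S), proj (sheaf.res a f) = a ≫ proj f
  /-- the right action of `H_P`, defined for pairs of points with the same image `x` in `X` -/
  act : ∀ {S : Sch k} {x : S ⟶ C.base} (f : sheaf.Sec S) (_ : HP P x),
    proj f ≫ fst C.base T = x → sheaf.Sec S
  proj_act : ∀ {S : Sch k} {x : S ⟶ C.base} (f : sheaf.Sec S) (h : HP P x)
    (e : proj f ≫ fst C.base T = x), proj (act f h e) = proj f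
  act_one : ∀ {S : Sch k} {x : S ⟶ C.base} (f : sheaf.Sec S) (e : proj f ≫ fst C.base T = x),
    act f (1 : HP P x) e = f
  act_mul : ∀ {S : Sch k} {x : S ⟶ C.base} (f : sheaf.Sec S) (h h' : HP P x)
    (e : proj f ≫ fst C.base T = x) (e' : proj (act f h e) ≫ fst C.base T = x),
    act f (h * h') e = act (act f h e) h' e'
  act_res : ∀ {S S' : Sch k} (a : S' ⟶ S) {x : S ⟶ C.base} (f : sheaf.Sec S) (h : HP P x)
    (e : proj f ≫ fst C.base T = x) (e' : proj (sheaf.res a f) ≫ fst C.base T = a ≫ x),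
    sheaf.res a (act f h e) = act (sheaf.res a f) (h.res a) e'
  simply_transitive : ∀ {S : Sch k} (f f' : sheaf.Sec S), proj f = proj f' →
    ∃! h : HP P (proj f ≫ fst C.base T), act f h rfl = f'
  locally_nonempty : ∀ {S : Sch k} (s : S ⟶ C.base ⊗ T), ∃ R ∈ etaleSite k S,
    ∀ {S' : Sch k} (a : S' ⟶ S), R.arrows a → ∃ f : sheaf.Sec S', proj f = a ≫ s

namespace HBundle

variable {P : GBundle ρ C} {T : Sch k} (F : HBundle P T)

/-- The points of `π^* F ×_{X̃ × T} (P × T)`: since `F` maps to `X × T`, these are the pairs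
`(f, p)` of a point of `F` and a point of `P` with the same image in `X`. -/
def Pair (S : Sch k) : Type (u + 1) :=
  {x : F.sheaf.Sec S × P.sheaf.Sec S // F.proj x.1 ≫ fst C.base T = P.proj x.2 ≫ C.map}

/-- The pair `(f, p)`. -/
def pair {S : Sch k} (f : F.sheaf.Sec S) (p : P.sheaf.Sec S)
    (e : F.proj f ≫ fst C.base T = P.proj p ≫ C.map) : F.Pair S := ⟨(f, p), e⟩

/-- Restriction of pairs. -/
def Pair.res {F : HBundle P T} {S S' : Sch k} (a : S' ⟶ S) (x : F.Pair S) : F.Pair S' :=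
  ⟨(F.sheaf.res a x.1.1, P.sheaf.res a x.1.2), by
    rw [F.proj_res, P.proj_res, Category.assoc, Category.assoc, x.2]⟩

/-- The action of `G` on pairs, `(f, p) g = (f, p g)`. -/
def Pair.smul {F : HBundle P T} {S : Sch k} (x : F.Pair S) (g : S ⟶ G.X) : F.Pair S :=
  F.pair x.1.1 (P.smul x.1.2 g) (by rw [P.proj_smul, x.2])

/-- The action of `Γ` on pairs, `σ (f, p) = (f, σ p)`. -/
def Pair.gsmul {F : HBundle P T} {S : Sch k} (σ : Γ) (x : F.Pair S) : F.Pair S :=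
  F.pair x.1.1 (P.gsmul σ x.1.2) (by rw [P.proj_gsmul, Category.assoc, C.act_map, x.2])

/-- The relation `(f h, p) ∼ (f, h p)` for `h` a point of `H_P`. -/
inductive Rel {S : Sch k} : F.Pair S → F.Pair S → Prop
  | mk {x : S ⟶ C.base} (h : HP P x) (f : F.sheaf.Sec S) (p : P.sheaf.Sec S)
    (hf : F.proj f ≫ fst C.base T = x) (hp : P.proj p ≫ C.map = x) :
    Rel (F.pair (F.act f h hf) p (by rw [F.proj_act, hf, hp]))
      (F.pair f (h.smul p hp) (by rw [h.proj_smul, hf, hp]))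

lemma Rel.res {F : HBundle P T} {S S' : Sch k} (a : S' ⟶ S) {x y : F.Pair S} (h : F.Rel x y) :
    F.Rel (x.res a) (y.res a) := by
  obtain @⟨s, h, f, p, hf, hp⟩ := h
  have hf' : F.proj (F.sheaf.res a f) ≫ fst C.base T = a ≫ s := by
    rw [F.proj_res, Category.assoc, hf]
  have hp' : P.proj (P.sheaf.res a p) ≫ C.map = a ≫ s := by
    rw [P.proj_res, Category.assoc, hp]
  have := Rel.mk (h.res a) (F.sheaf.res a f) (P.sheaf.res a p) hf' hp'
  convert this using 1
  · exact Subtype.ext (Prod.ext (F.act_res a f h hf hf') rfl)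
  · exact Subtype.ext (Prod.ext rfl (h.res_smul a p hp hp'))

/-- The presheaf quotient of `π^* F ×_{X̃ × T} (P × T)` by `(f h, p) ∼ (f, h p)`. -/
def quotientPresheaf : (Sch k)ᵒᵖ ⥤ Type (u + 1) where
  obj S := Quot (F.Rel (S := S.unop))
  map a := ↾(Quot.map (Pair.res a.unop) fun _ _ h => h.res a.unop)
  map_id S := by
    ext x
    obtain ⟨x⟩ := x
    exact congrArg (Quot.mk _) (Subtype.ext (Prod.ext (EtSheaf.res_id _ _) (EtSheaf.res_id _ _)))
  map_comp a b := by
    ext x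
    obtain ⟨x⟩ := x
    exact congrArg (Quot.mk _)
      (Subtype.ext (Prod.ext (EtSheaf.res_comp _ _ _ _) (EtSheaf.res_comp _ _ _ _)))

/-- The contracted product `π^* F ×^{π^* H_P} P` (its total space): the étale sheaf quotient of
`π^* F ×_{X̃ × T} (P × T)` by `(f h, p) ∼ (f, h p)`. -/
def contractedProduct : EtSheaf k := (presheafToSheaf (etaleSite k) _).obj F.quotientPresheaf

/-- The class `[f, p]` in the contracted product of a pair `(f, p)`. -/
def cls {S : Sch k} (x : F.Pair S) : F.contractedProduct.Sec S :=
  (toSheafify (etaleSite k) F.quotientPresheaf).app (op S) (Quot.mk _ x)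

end HBundle

/-! ### The stacks -/

/-- The objects of the stack of `H_P`-bundles: a `k`-scheme `T` and an `H_P`-bundle on `X × T`. -/
structure BunH (P : GBundle ρ C) where
  T : Sch k
  bundle : HBundle P T

/-- A morphism `F ⟶ F'` over `base : T ⟶ T'` is an `H_P`-equivariant map of total spaces which
lies over `X × T ⟶ X × T'` (equivalently, an isomorphism from `F` to the pullback of `F'`). -/
@[ext]
structure BunH.Hom {P : GBundle ρ C} (F F' : BunH P) where
  base : F.T ⟶ F'.T
  map : F.bundle.sheaf ⟶ F'.bundle.sheaf
  proj_map : ∀ {S : Sch k} (f : F.bundle.sheaf.Sec S),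
    F'.bundle.proj (EtSheaf.ap map f) = F.bundle.proj f ≫ C.base ◁ base
  map_act : ∀ {S : Sch k} {x : S ⟶ C.base} (f : F.bundle.sheaf.Sec S) (h : HP P x)
    (e : F.bundle.proj f ≫ fst C.base F.T = x)
    (e' : F'.bundle.proj (EtSheaf.ap map f) ≫ fst C.base F'.T = x),
    EtSheaf.ap map (F.bundle.act f h e) = F'.bundle.act (EtSheaf.ap map f) h e'

instance (P : GBundle ρ C) : Category (BunH P) where
  Hom := BunH.Hom
  id F :=
    { base := 𝟙 _
      map := 𝟙 _
      proj_map := fun f => by simp [EtSheaf.ap]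
      map_act := fun _ _ _ _ => rfl }
  comp {F F' F''} u v :=
    { base := u.base ≫ v.base
      map := u.map ≫ v.map
      proj_map := fun f => by
        change F''.bundle.proj (EtSheaf.ap v.map (EtSheaf.ap u.map f)) = _
        rw [v.proj_map, u.proj_map, Category.assoc, ← MonoidalCategory.whiskerLeft_comp]
      map_act := fun {_ x} f h e e' => by
        have e'' : F'.bundle.proj (EtSheaf.ap u.map f) ≫ fst C.base F'.T = x := by
          rw [u.proj_map, Category.assoc, whiskerLeft_fst, e]
        change EtSheaf.ap v.map (EtSheaf.ap u.map _) = _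
        rw [u.map_act f h e e'', v.map_act _ h e'' e']
        rfl }
  id_comp _ := BunH.Hom.ext (Category.id_comp _) (Category.id_comp _)
  comp_id _ := BunH.Hom.ext (Category.comp_id _) (Category.comp_id _)
  assoc _ _ _ := BunH.Hom.ext (Category.assoc _ _ _) (Category.assoc _ _ _)

/-- The stack `Bun_{H_P}` of `H_P`-bundles, as a category over the category of `k`-schemes. -/
def bunH (P : GBundle ρ C) : BasedCategory (Sch k) where
  obj := BunH P
  p :=
    { obj := fun F => F.T
      map := fun u => BunH.Hom.base u }

/-- The objects of the stack `Bun^P_{(Γ,G)}`: a `k`-scheme `T` and a `(Γ, G)`-bundle on `X̃ × T`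
which has the same local type as `P × T`. -/
structure BunG (P : GBundle ρ C) where
  T : Sch k
  bundle : GBundle ρ (C.prod T)
  sameLocalType : SameLocalType (P.prod T) bundle

/-- A morphism `Q ⟶ Q'` over `base : T ⟶ T'` is a `Γ`- and `G`-equivariant map of total spaces
which lies over `X̃ × T ⟶ X̃ × T'` (equivalently, an isomorphism from `Q` to the pullback of
`Q'`). -/
@[ext]
structure BunG.Hom {P : GBundle ρ C} (Q Q' : BunG P) where
  base : Q.T ⟶ Q'.T
  map : Q.bundle.sheaf ⟶ Q'.bundle.sheaf
  proj_map : ∀ {S : Sch k} (q : Q.bundle.sheaf.Sec S),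
    Q'.bundle.proj (EtSheaf.ap map q) = Q.bundle.proj q ≫ C.total ◁ base
  map_smul : ∀ {S : Sch k} (q : Q.bundle.sheaf.Sec S) (g : S ⟶ G.X),
    EtSheaf.ap map (Q.bundle.smul q g) = Q'.bundle.smul (EtSheaf.ap map q) g
  map_gsmul : ∀ {S : Sch k} (σ : Γ) (q : Q.bundle.sheaf.Sec S),
    EtSheaf.ap map (Q.bundle.gsmul σ q) = Q'.bundle.gsmul σ (EtSheaf.ap map q)

instance (P : GBundle ρ C) : Category (BunG P) where
  Hom := BunG.Hom
  id Q :=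
    { base := 𝟙 _
      map := 𝟙 _
      proj_map := fun q => by
        rw [MonoidalCategory.whiskerLeft_id]
        exact (Category.comp_id _).symm
      map_smul := fun _ _ => rfl
      map_gsmul := fun _ _ => rfl }
  comp {Q Q' Q''} u v :=
    { base := u.base ≫ v.base
      map := u.map ≫ v.map
      proj_map := fun q => by
        change Q''.bundle.proj (EtSheaf.ap v.map (EtSheaf.ap u.map q)) = _
        rw [v.proj_map, u.proj_map, MonoidalCategory.whiskerLeft_comp]
        exact Category.assoc _ _ _
      map_smul := fun q g => by
        change EtSheaf.ap v.map (EtSheaf.ap u.map _) = _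
        rw [u.map_smul, v.map_smul]
        rfl
      map_gsmul := fun σ q => by
        change EtSheaf.ap v.map (EtSheaf.ap u.map _) = _
        rw [u.map_gsmul, v.map_gsmul]
        rfl }
  id_comp _ := BunG.Hom.ext (Category.id_comp _) (Category.id_comp _)
  comp_id _ := BunG.Hom.ext (Category.comp_id _) (Category.comp_id _)
  assoc _ _ _ := BunG.Hom.ext (Category.assoc _ _ _) (Category.assoc _ _ _)

/-- The map on pairs `(f, p) ↦ (u f, p)` induced by a morphism `u` of `H_P`-bundles. -/
def BunH.Hom.pairMap {P : GBundle ρ C} {F F' : BunH P} (u : BunH.Hom F F') {S : Sch k}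
    (x : F.bundle.Pair S) : F'.bundle.Pair S :=
  F'.bundle.pair (EtSheaf.ap u.map x.1.1) x.1.2
    (by rw [u.proj_map, Category.assoc, whiskerLeft_fst, x.2])

/-- The stack `Bun^P_{(Γ,G)}` of `(Γ, G)`-bundles with the same local type as `P`, as a category
over the category of `k`-schemes. -/
def bunG (P : GBundle ρ C) : BasedCategory (Sch k) where
  obj := BunG P
  p :=
    { obj := fun Q => Q.T
      map := fun u => BunG.Hom.base u }

/-- The isomorphism of étale sheaves `e` identifies the contracted product
`π^* F ×^{π^* H_P} P`, with the structure induced by that of `P`, with the `(Γ, G)`-bundle `Q`: the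
class `[f, p]` lies over the image of `p` in `X̃` and the image of `f` in `T`, and
`[f, p] g = [f, p g]`, `σ [f, p] = [f, σ p]`.

(Locally, every point of the contracted product is of the form `[f, p]`.) -/
structure IsContractedProduct {P : GBundle ρ C} (F : BunH P) (Q : BunG P) (hT : Q.T = F.T)
    (e : F.bundle.contractedProduct ≅ Q.bundle.sheaf) : Prop where
  proj_total : ∀ {S : Sch k} (x : F.bundle.Pair S),
    Q.bundle.proj (EtSheaf.ap e.hom (F.bundle.cls x)) ≫ fst C.total Q.T = P.proj x.1.2
  proj_T : ∀ {S : Sch k} (x : F.bundle.Pair S),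
    Q.bundle.proj (EtSheaf.ap e.hom (F.bundle.cls x)) ≫ snd C.total Q.T ≫ eqToHom hT =
      F.bundle.proj x.1.1 ≫ snd C.base F.T
  smul : ∀ {S : Sch k} (x : F.bundle.Pair S) (g : S ⟶ G.X),
    Q.bundle.smul (EtSheaf.ap e.hom (F.bundle.cls x)) g =
      EtSheaf.ap e.hom (F.bundle.cls (x.smul g))
  gsmul : ∀ {S : Sch k} (σ : Γ) (x : F.bundle.Pair S),
    Q.bundle.gsmul σ (EtSheaf.ap e.hom (F.bundle.cls x)) =
      EtSheaf.ap e.hom (F.bundle.cls (x.gsmul σ))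

end Bundles
end GammaBundle

end

/-!
Locally on `X × T` an `H_P`-torsor `F` has a section `f`, and then every class `[f', p]` over the
image of `f` has a unique representative with first component `f`. So `p ↦ [f, p]` is, over the
image of `f`, a `Γ`-invariant isomorphism from `P × T` to the contracted product. The projection
and the actions of `G` and `Γ` on the contracted product are obtained by descent from pairs, and
all torsor axioms can be checked after such a trivialization. Étale covers of a geometric point
split, so that `F` has a section over it, which gives the equality of local types.

Since an equivariant map of `G`-torsors is bijective on fibres, `Bun^P_{(Γ,G)}` is fibred in
groupoids: each of its morphisms is strongly Cartesian.
-/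

noncomputable section

namespace GammaBundle

section Descent

variable {𝒞 : Type*} [Category 𝒞] {J : GrothendieckTopology 𝒞} {E : 𝒞ᵒᵖ ⥤ Type*} {X : 𝒞}

lemma exists_amalgamation (hE : Presieve.IsSheaf J E)
    (p : ∀ ⦃Y : 𝒞⦄, (Y ⟶ X) → E.obj (op Y) → Prop)
    (p_map : ∀ ⦃Y Z : 𝒞⦄ (b : Z ⟶ Y) (a : Y ⟶ X) (y : E.obj (op Y)),
      p a y → p (b ≫ a) (E.map b.op y))
    (p_unique : ∀ ⦃Y : 𝒞⦄ (a : Y ⟶ X) (y y' : E.obj (op Y)), p a y → p a y' → y = y')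
    {R : Sieve X} (hR : R ∈ J X) (p_exists : ∀ ⦃Y : 𝒞⦄ (a : Y ⟶ X), R.arrows a → ∃ y, p a y) :
    ∃ x : E.obj (op X), ∀ ⦃Y : 𝒞⦄ (a : Y ⟶ X) (y : E.obj (op Y)), p a y → E.map a.op x = y := by
  choose s hs using p_exists
  obtain ⟨x, hx, -⟩ := hE R hR s fun Y₁ Y₂ Z g₁ g₂ f₁ f₂ h₁ h₂ e =>
    p_unique (g₁ ≫ f₁) _ _ (p_map _ _ _ (hs f₁ h₁)) (e ▸ p_map _ _ _ (hs f₂ h₂))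
  refine ⟨x, fun Y a y hy => (hE.isSeparated _ (J.pullback_stable a hR)).ext fun Z b hb => ?_⟩
  rw [← Functor.map_comp_apply, ← op_comp, hx _ hb]
  exact p_unique _ _ _ (hs _ hb) (p_map b a y hy)

variable {A B : 𝒞ᵒᵖ ⥤ Type v} (f : A ⟶ B) [Presheaf.IsLocallySurjective J f]

include f in
lemma ext_of_isLocallySurjective (hE : Presieve.IsSheaf J E) (b : B.obj (op X))
    {e e' : E.obj (op X)} (h : ∀ ⦃Y : 𝒞⦄ (a : Y ⟶ X) (x : A.obj (op Y)),
      f.app (op Y) x = B.map a.op b → E.map a.op e = E.map a.op e') : e = e' :=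
  (hE.isSeparated _ (Presheaf.imageSieve_mem J f b)).ext fun _ a ⟨x, hx⟩ => h a x hx

lemma exists_descent (hE : Presieve.IsSheaf J E)
    (φ : ∀ ⦃Y : 𝒞⦄, (Y ⟶ X) → A.obj (op Y) → E.obj (op Y))
    (φ_map : ∀ ⦃Y Z : 𝒞⦄ (c : Z ⟶ Y) (a : Y ⟶ X) (x : A.obj (op Y)),
      E.map c.op (φ a x) = φ (c ≫ a) (A.map c.op x))
    (φ_congr : ∀ ⦃Y : 𝒞⦄ (a : Y ⟶ X) (x x' : A.obj (op Y)),
      f.app (op Y) x = f.app (op Y) x' → φ a x = φ a x')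
    (b : B.obj (op X)) :
    ∃ e : E.obj (op X), ∀ ⦃Y : 𝒞⦄ (a : Y ⟶ X) (x : A.obj (op Y)),
      f.app (op Y) x = B.map a.op b → E.map a.op e = φ a x := by
  obtain ⟨e, he⟩ := exists_amalgamation hE
    (fun Y a y => ∃ x : A.obj (op Y), f.app (op Y) x = B.map a.op b ∧ φ a x = y)
    (by
      rintro Y Z c a _ ⟨x, hx, rfl⟩
      refine ⟨A.map c.op x, ?_, (φ_map c a x).symm⟩
      rw [NatTrans.naturality_apply, hx, op_comp, Functor.map_comp_apply])
    (by
      rintro Y a _ _ ⟨x, hx, rfl⟩ ⟨x', hx', rfl⟩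
      exact φ_congr a x x' (hx.trans hx'.symm))
    (Presheaf.imageSieve_mem J f b) fun Y a ⟨x, hx⟩ => ⟨_, x, hx, rfl⟩
  exact ⟨e, fun Y a x hx => he a _ ⟨x, hx, rfl⟩⟩

/-- Descent along a locally surjective map `f : A ⟶ B` to a sheaf `E`: the value at `b` of the map
to `E` that sends `f x` to `φ x`. The family `φ` need only be defined over `X`, so that it may
depend on further sections over `X`. -/
def descend (hE : Presieve.IsSheaf J E)
    (φ : ∀ ⦃Y : 𝒞⦄, (Y ⟶ X) → A.obj (op Y) → E.obj (op Y))
    (φ_map : ∀ ⦃Y Z : 𝒞⦄ (c : Z ⟶ Y) (a : Y ⟶ X) (x : A.obj (op Y)),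
      E.map c.op (φ a x) = φ (c ≫ a) (A.map c.op x))
    (φ_congr : ∀ ⦃Y : 𝒞⦄ (a : Y ⟶ X) (x x' : A.obj (op Y)),
      f.app (op Y) x = f.app (op Y) x' → φ a x = φ a x')
    (b : B.obj (op X)) : E.obj (op X) :=
  (exists_descent f hE φ φ_map φ_congr b).choose

lemma map_descend (hE : Presieve.IsSheaf J E)
    (φ : ∀ ⦃Y : 𝒞⦄, (Y ⟶ X) → A.obj (op Y) → E.obj (op Y))
    (φ_map : ∀ ⦃Y Z : 𝒞⦄ (c : Z ⟶ Y) (a : Y ⟶ X) (x : A.obj (op Y)),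
      E.map c.op (φ a x) = φ (c ≫ a) (A.map c.op x))
    (φ_congr : ∀ ⦃Y : 𝒞⦄ (a : Y ⟶ X) (x x' : A.obj (op Y)),
      f.app (op Y) x = f.app (op Y) x' → φ a x = φ a x')
    (b : B.obj (op X)) ⦃Y : 𝒞⦄ (a : Y ⟶ X) (x : A.obj (op Y))
    (hx : f.app (op Y) x = B.map a.op b) :
    E.map a.op (descend f hE φ φ_map φ_congr b) = φ a x :=
  (exists_descent f hE φ φ_map φ_congr b).choose_spec a x hx

end Descent

section EtaleSite

lemma id_mem_of_mem_over_etaleTopology {Ω : Type u} [Field Ω] [IsSepClosed Ω] {B : Scheme.{u}}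
    (f : Spec (CommRingCat.of Ω) ⟶ B) {R : Sieve (Over.mk f)}
    (hR : R ∈ Scheme.etaleTopology.over B (Over.mk f)) : R.arrows (𝟙 (Over.mk f)) := by
  obtain ⟨Y, g, hg, y, hy : y ≫ g = 𝟙 _⟩ := (Scheme.geometricFiber Ω).jointly_surjective _
    ((GrothendieckTopology.mem_over_iff _ _).1 hR) (𝟙 _)
  have h_id := (Sieve.overEquiv (Over.mk f) R).downward_closed hg y
  rw [hy] at h_id
  rwa [← (Sieve.overEquiv (Over.mk f)).symm_apply_apply R]

variable {k : Type u} [Field k] {S T : Sch k} {R : Sieve S}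

lemma EtSheaf.isSheaf (F : EtSheaf k) : Presieve.IsSheaf (etaleSite k) F.obj :=
  (isSheaf_iff_isSheaf_of_type _ _).1 F.property

lemma isSheaf_yoneda (T : Sch k) : Presieve.IsSheaf (etaleSite k) (yoneda.obj T) :=
  GrothendieckTopology.Subcanonical.isSheaf_of_isRepresentable _

lemma EtSheaf.ext_of_cover (F : EtSheaf k) (hR : R ∈ etaleSite k S) {x y : F.Sec S}
    (h : ∀ ⦃S' : Sch k⦄ (a : S' ⟶ S), R.arrows a → F.res a x = F.res a y) : x = y :=
  (F.isSheaf.isSeparated R hR).ext h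

lemma hom_ext_of_cover (hR : R ∈ etaleSite k S) {x y : S ⟶ T}
    (h : ∀ ⦃S' : Sch k⦄ (a : S' ⟶ S), R.arrows a → a ≫ x = a ≫ y) : x = y :=
  ((isSheaf_yoneda T).isSeparated R hR).ext h

end EtaleSite

section Bundles

variable {k : Type u} [Field k] {Γ : Type v} [Group Γ]
variable {G : Grp (Sch k)} {ρ : Γ →* Aut G} {C : EquivMap k Γ}

lemma WeilIso.val_toEquiv_congr {P Q : GBundle ρ C} {S : Sch k} {s : S ⟶ C.base}
    (φ : WeilIso P Q s) {S' : Sch k} {a a' : S' ⟶ S} {y y' : S' ⟶ C.total}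
    (e : a ≫ s = y ≫ C.map) (e' : a' ≫ s = y' ≫ C.map) {p : P.Fib y} {p' : P.Fib y'}
    (ha : a = a') (hp : p.1 = p'.1) : (φ.toEquiv a y e p).1 = (φ.toEquiv a' y' e' p').1 := by
  subst ha
  obtain rfl : y = y' := by rw [← p.2, ← p'.2, hp]
  obtain rfl : p = p' := Subtype.ext hp
  rfl

namespace HP

variable {P : GBundle ρ C} {S : Sch k} {s : S ⟶ C.base}

lemma one_smul (p : P.sheaf.Sec S) (e : P.proj p ≫ C.map = s) : (1 : HP P s).smul p e = p := rfl

lemma mul_smul (φ ψ : HP P s) (p : P.sheaf.Sec S) (e : P.proj p ≫ C.map = s)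
    (e' : P.proj (ψ.smul p e) ≫ C.map = s) : (φ * ψ).smul p e = φ.smul (ψ.smul p e) e' :=
  φ.1.val_toEquiv_congr _ _ rfl rfl

lemma smul_smul_comm (φ : HP P s) (p : P.sheaf.Sec S) (g : S ⟶ G.X) (e : P.proj p ≫ C.map = s)
    (e' : P.proj (P.smul p g) ≫ C.map = s) :
    φ.smul (P.smul p g) e' = P.smul (φ.smul p e) g :=
  have e_id : 𝟙 S ≫ s = P.proj p ≫ C.map := by rw [Category.id_comp, e]
  (φ.1.val_toEquiv_congr (p := ⟨P.smul p g, rfl⟩) (p' := GBundle.Fib.smul ⟨p, rfl⟩ g)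
    _ e_id rfl rfl).trans
    (congrArg Subtype.val (φ.1.equivariant (𝟙 S) (P.proj p) e_id ⟨p, rfl⟩ g))

lemma smul_gsmul_comm (φ : HP P s) (σ : Γ) (p : P.sheaf.Sec S) (e : P.proj p ≫ C.map = s)
    (e' : P.proj (P.gsmul σ p) ≫ C.map = s) :
    φ.smul (P.gsmul σ p) e' = P.gsmul σ (φ.smul p e) :=
  have e_id : 𝟙 S ≫ s = P.proj p ≫ C.map := by rw [Category.id_comp, e]
  have e_act : 𝟙 S ≫ s = (P.proj p ≫ (C.act σ).hom) ≫ C.map := by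
    rw [Category.assoc, C.act_map, e_id]
  (φ.1.val_toEquiv_congr (p := ⟨P.gsmul σ p, rfl⟩) _ e_act rfl rfl).trans
    (congrArg Subtype.val (φ.2 σ (𝟙 S) (P.proj p) e_id e_act ⟨p, rfl⟩))

end HP

lemma GBundle.smul_left_cancel (Q : GBundle ρ C) {S : Sch k} (q : Q.sheaf.Sec S)
    {g g' : S ⟶ G.X} (h : Q.smul q g = Q.smul q g') : g = g' :=
  (Q.simply_transitive q (Q.smul q g') (Q.proj_smul _ _).symm).unique h rfl

namespace HBundle

variable {P : GBundle ρ C} {T : Sch k} {F : HBundle P T} {S : Sch k}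

section Pairs

lemma Pair.res_smul {S' : Sch k} (a : S' ⟶ S) (x : F.Pair S) (g : S ⟶ G.X) :
    (x.smul g).res a = (x.res a).smul (a ≫ g) :=
  Subtype.ext (Prod.ext rfl (P.smul_res _ _ _))

lemma Pair.res_gsmul {S' : Sch k} (a : S' ⟶ S) (σ : Γ) (x : F.Pair S) :
    (x.gsmul σ).res a = (x.res a).gsmul σ :=
  Subtype.ext (Prod.ext rfl (P.gsmul_res _ _ _))

lemma Pair.smul_one (x : F.Pair S) : x.smul 1 = x :=
  Subtype.ext (Prod.ext rfl (P.smul_one _))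

lemma Pair.smul_mul (x : F.Pair S) (g g' : S ⟶ G.X) : x.smul (g * g') = (x.smul g).smul g' :=
  Subtype.ext (Prod.ext rfl (P.smul_mul _ _ _))

lemma Pair.gsmul_one (x : F.Pair S) : x.gsmul 1 = x :=
  Subtype.ext (Prod.ext rfl (P.gsmul_one _))

lemma Pair.gsmul_mul (σ τ : Γ) (x : F.Pair S) : x.gsmul (σ * τ) = (x.gsmul τ).gsmul σ :=
  Subtype.ext (Prod.ext rfl (P.gsmul_mul _ _ _))

lemma Pair.gsmul_smul (σ : Γ) (x : F.Pair S) (g : S ⟶ G.X) :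
    (x.smul g).gsmul σ = (x.gsmul σ).smul (g ≫ (ρ σ).hom.hom.hom) :=
  Subtype.ext (Prod.ext rfl (P.gsmul_smul _ _ _))

/-- The point of `X̃ × T` below the pair `(f, p)`. -/
def Pair.proj (x : F.Pair S) : S ⟶ C.total ⊗ T :=
  lift (P.proj x.1.2) (F.proj x.1.1 ≫ snd C.base T)

lemma Pair.proj_whiskerRight_map (x : F.Pair S) : x.proj ≫ C.map ▷ T = F.proj x.1.1 := by
  rw [Pair.proj, lift_whiskerRight, ← x.2, ← comp_lift, lift_fst_snd, Category.comp_id]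

lemma Pair.proj_eq {x : F.Pair S} {y : S ⟶ C.total ⊗ T} (hf : F.proj x.1.1 = y ≫ C.map ▷ T)
    (hp : P.proj x.1.2 = y ≫ fst C.total T) : x.proj = y := by
  rw [Pair.proj, hp, hf, Category.assoc, whiskerRight_snd, ← comp_lift, lift_fst_snd,
    Category.comp_id]

lemma Pair.proj_res {S' : Sch k} (a : S' ⟶ S) (x : F.Pair S) : (x.res a).proj = a ≫ x.proj := by
  rw [Pair.proj, Pair.proj, comp_lift, ← Category.assoc, ← F.proj_res, ← P.proj_res]
  rfl

lemma Pair.proj_smul (x : F.Pair S) (g : S ⟶ G.X) : (x.smul g).proj = x.proj :=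
  congrArg (lift · _) (P.proj_smul x.1.2 g)

lemma Pair.proj_gsmul (σ : Γ) (x : F.Pair S) :
    (x.gsmul σ).proj = x.proj ≫ (C.act σ).hom ▷ T := by
  rw [Pair.proj, Pair.proj, lift_whiskerRight, ← P.proj_gsmul]
  rfl

end Pairs

section Relation

lemma rel_iff {x y : F.Pair S} : F.Rel x y ↔ ∃ (s : S ⟶ C.base) (h : HP P s)
    (e : F.proj y.1.1 ≫ fst C.base T = s) (e' : P.proj x.1.2 ≫ C.map = s),
    F.act y.1.1 h e = x.1.1 ∧ h.smul x.1.2 e' = y.1.2 := by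
  constructor
  · rintro ⟨h, f, p, hf, hp⟩
    exact ⟨_, h, hf, hp, rfl, rfl⟩
  · obtain ⟨⟨_, p⟩, _⟩ := x
    obtain ⟨⟨f, _⟩, _⟩ := y
    rintro ⟨s, h, e, e', hf, hp⟩
    dsimp only at e e' hf hp
    subst hf hp
    exact Rel.mk h f p e e'

lemma Rel.refl (x : F.Pair S) : F.Rel x x :=
  rel_iff.2 ⟨_, 1, x.2, rfl, F.act_one _ _, HP.one_smul _ _⟩

lemma Rel.symm {x y : F.Pair S} (hxy : F.Rel x y) : F.Rel y x := by
  obtain ⟨h, f, p, e, e'⟩ := hxy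
  refine rel_iff.2 ⟨_, h⁻¹, (congrArg (· ≫ _) (F.proj_act f h e)).trans e,
    (congrArg (· ≫ _) (h.proj_smul p e')).trans e', ?_, ?_⟩
  · exact (F.act_mul _ _ _ _ _).symm.trans (by rw [mul_inv_cancel, F.act_one]; rfl)
  · exact (HP.mul_smul _ _ _ _ _).symm.trans (by rw [inv_mul_cancel, HP.one_smul]; rfl)

lemma Rel.trans {x y z : F.Pair S} (hxy : F.Rel x y) (hyz : F.Rel y z) : F.Rel x z := by
  obtain ⟨s, h, e, e', hf, hp⟩ := rel_iff.1 hxy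
  obtain ⟨s', h', e₁, e₁', hf', hp'⟩ := rel_iff.1 hyz
  obtain rfl : s' = s := by rw [← e₁, ← e, ← hf', F.proj_act]
  refine rel_iff.2 ⟨s', h' * h, e₁, e', ?_, ?_⟩
  · rw [F.act_mul _ _ _ _ (by rw [F.proj_act, e₁]), ← hf]
    congr 1
  · rw [HP.mul_smul _ _ _ _ (by rw [HP.proj_smul, e']), ← hp']
    congr 1

variable (F S) in
lemma rel_equivalence : Equivalence (F.Rel (S := S)) := ⟨Rel.refl, Rel.symm, Rel.trans⟩

lemma Rel.proj_eq {x y : F.Pair S} (hxy : F.Rel x y) : x.proj = y.proj := by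
  obtain ⟨h, f, p, e, e'⟩ := hxy
  exact congrArg₂ (fun s t => lift s (t ≫ snd C.base T)) (h.proj_smul p e').symm (F.proj_act f h e)

lemma Rel.smul {x y : F.Pair S} (hxy : F.Rel x y) (g : S ⟶ G.X) :
    F.Rel (x.smul g) (y.smul g) := by
  obtain @⟨s, h, f, p, e, e'⟩ := hxy
  have e_smul : P.proj (P.smul p g) ≫ C.map = s := by rw [P.proj_smul, e']
  exact rel_iff.2 ⟨s, h, e, e_smul, rfl, h.smul_smul_comm p g e' e_smul⟩

lemma Rel.gsmul {x y : F.Pair S} (σ : Γ) (hxy : F.Rel x y) :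
    F.Rel (x.gsmul σ) (y.gsmul σ) := by
  obtain @⟨s, h, f, p, e, e'⟩ := hxy
  have e_gsmul : P.proj (P.gsmul σ p) ≫ C.map = s := by
    rw [P.proj_gsmul, Category.assoc, C.act_map, e']
  exact rel_iff.2 ⟨s, h, e, e_gsmul, rfl, h.smul_gsmul_comm σ p e' e_gsmul⟩

lemma act_left_cancel {s : S ⟶ C.base} (f : F.sheaf.Sec S) {h h' : HP P s}
    (e : F.proj f ≫ fst C.base T = s) (hf : F.act f h e = F.act f h' e) : h = h' := by
  subst e
  exact (F.simply_transitive f (F.act f h' rfl) (F.proj_act _ _ _).symm).unique hf rfl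

lemma Rel.eq_of_left_eq {x y : F.Pair S} (hxy : F.Rel x y) (hf : x.1.1 = y.1.1) : x = y := by
  obtain ⟨s, h, e, e', h_act, h_smul⟩ := rel_iff.1 hxy
  obtain rfl : h = 1 := act_left_cancel _ e (by rw [h_act, hf, F.act_one])
  exact Subtype.ext (Prod.ext hf h_smul)

lemma Rel.smul_left_cancel {x : F.Pair S} {g g' : S ⟶ G.X} (h : F.Rel (x.smul g) (x.smul g')) :
    g = g' :=
  P.smul_left_cancel x.1.2 (congrArg (fun y : F.Pair S => y.1.2) (h.eq_of_left_eq rfl))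

lemma exists_rel_left_eq (x : F.Pair S) (f : F.sheaf.Sec S) (hf : F.proj x.1.1 = F.proj f) :
    ∃ y : F.Pair S, F.Rel x y ∧ y.1.1 = f := by
  obtain ⟨h, hh, -⟩ := F.simply_transitive f x.1.1 hf.symm
  have e : P.proj x.1.2 ≫ C.map = F.proj f ≫ fst C.base T := by rw [← hf, x.2]
  exact ⟨F.pair f (h.smul x.1.2 e) (by rw [HP.proj_smul, e]),
    rel_iff.2 ⟨_, h, rfl, e, hh, rfl⟩, rfl⟩

lemma Pair.ext_of_cover {R : Sieve S} (hR : R ∈ etaleSite k S) {x y : F.Pair S}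
    (h : ∀ ⦃S' : Sch k⦄ (a : S' ⟶ S), R.arrows a → x.res a = y.res a) : x = y :=
  Subtype.ext (Prod.ext
    (F.sheaf.ext_of_cover hR fun _ a ha => congrArg (·.1.1) (h a ha))
    (P.sheaf.ext_of_cover hR fun _ a ha => congrArg (·.1.2) (h a ha)))

lemma rel_of_cover {R : Sieve S} (hR : R ∈ etaleSite k S) {x y : F.Pair S}
    (h : ∀ ⦃S' : Sch k⦄ (a : S' ⟶ S), R.arrows a → F.Rel (x.res a) (y.res a)) : F.Rel x y := by
  have h_proj : x.proj = y.proj := hom_ext_of_cover hR fun S' a ha => by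
    rw [← Pair.proj_res, ← Pair.proj_res, (h a ha).proj_eq]
  obtain ⟨z, hxz, hz⟩ := exists_rel_left_eq x y.1.1
    (by rw [← Pair.proj_whiskerRight_map, h_proj, Pair.proj_whiskerRight_map])
  obtain rfl : z = y := Pair.ext_of_cover hR fun S' a ha =>
    ((hxz.res a).symm.trans (h a ha)).eq_of_left_eq (congrArg (F.sheaf.res a) hz)
  exact hxz

end Relation

section ContractedProduct

variable (F) in
/-- The presheaf `π^* F ×_{X̃ × T} (P × T)` of pairs. -/
def pairPresheaf : (Sch k)ᵒᵖ ⥤ Type (u + 1) where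
  obj S := F.Pair S.unop
  map a := ↾(Pair.res a.unop)
  map_id S := by
    ext x
    exact Subtype.ext (Prod.ext (EtSheaf.res_id _ _) (EtSheaf.res_id _ _))
  map_comp a b := by
    ext x
    exact Subtype.ext (Prod.ext (EtSheaf.res_comp _ _ _ _) (EtSheaf.res_comp _ _ _ _))

variable (F) in
/-- The quotient map from pairs to the presheaf quotient by `(f h, p) ∼ (f, h p)`. -/
def quotientMk : F.pairPresheaf ⟶ F.quotientPresheaf where
  app _ := ↾(Quot.mk _)
  naturality _ _ _ := rfl

instance : Presheaf.IsLocallySurjective (etaleSite k) F.quotientMk :=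
  Presheaf.isLocallySurjective_of_surjective _ _ fun _ => Quot.mk_surjective

variable (F) in
/-- The map `(f, p) ↦ [f, p]` from pairs to the contracted product. -/
def clsHom : F.pairPresheaf ⟶ F.contractedProduct.obj :=
  F.quotientMk ≫ toSheafify (etaleSite k) F.quotientPresheaf

instance : Presheaf.IsLocallySurjective (etaleSite k) F.clsHom :=
  inferInstanceAs (Presheaf.IsLocallySurjective _
    (F.quotientMk ≫ toSheafify (etaleSite k) F.quotientPresheaf))

lemma res_cls {S' : Sch k} (a : S' ⟶ S) (x : F.Pair S) :
    F.contractedProduct.res a (F.cls x) = F.cls (x.res a) :=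
  (NatTrans.naturality_apply F.clsHom a.op x).symm

lemma cls_eq_iff {x y : F.Pair S} : F.cls x = F.cls y ↔ F.Rel x y := by
  refine ⟨fun h => ?_, fun h =>
    congrArg ((toSheafify (etaleSite k) F.quotientPresheaf).app (op S)) (Quot.sound h)⟩
  have h_cover := Presheaf.equalizerSieve_mem (etaleSite k)
    (toSheafify (etaleSite k) F.quotientPresheaf) (X := op S) (Quot.mk _ x) (Quot.mk _ y) h
  exact rel_of_cover h_cover fun S' a ha => ((F.rel_equivalence S').quot_mk_eq_iff _ _).1 ha

lemma sec_ext {E : EtSheaf k} (q : F.contractedProduct.Sec S) {e e' : E.Sec S}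
    (h : ∀ ⦃S' : Sch k⦄ (a : S' ⟶ S) (x : F.Pair S'),
      F.cls x = F.contractedProduct.res a q → E.res a e = E.res a e') : e = e' :=
  ext_of_isLocallySurjective F.clsHom E.isSheaf q h

lemma hom_ext {Y : Sch k} (q : F.contractedProduct.Sec S) {e e' : S ⟶ Y}
    (h : ∀ ⦃S' : Sch k⦄ (a : S' ⟶ S) (x : F.Pair S'),
      F.cls x = F.contractedProduct.res a q → a ≫ e = a ≫ e') : e = e' :=
  ext_of_isLocallySurjective F.clsHom (isSheaf_yoneda Y) q h

variable (F) in
/-- The projection of the contracted product to `X̃ × T`. -/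
def cproj (q : F.contractedProduct.Sec S) : S ⟶ C.total ⊗ T :=
  descend F.clsHom (isSheaf_yoneda (C.total ⊗ T)) (fun _ _ x => x.proj)
    (fun _ _ c _ x => (Pair.proj_res c x).symm) (fun _ _ _ _ h => (cls_eq_iff.1 h).proj_eq) q

lemma comp_cproj {S' : Sch k} (a : S' ⟶ S) {q : F.contractedProduct.Sec S} {x : F.Pair S'}
    (hx : F.cls x = F.contractedProduct.res a q) : a ≫ F.cproj q = x.proj :=
  map_descend F.clsHom (isSheaf_yoneda (C.total ⊗ T)) _ _ _ q a x hx

variable (F) in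
/-- The right action of `G` on the contracted product. -/
def csmul (q : F.contractedProduct.Sec S) (g : S ⟶ G.X) : F.contractedProduct.Sec S :=
  descend F.clsHom F.contractedProduct.isSheaf (fun _ a x => F.cls (x.smul (a ≫ g)))
    (fun _ _ c a x => (res_cls c _).trans (congrArg F.cls
      ((Pair.res_smul c x (a ≫ g)).trans (congrArg _ (Category.assoc c a g).symm))))
    (fun _ _ _ _ h => cls_eq_iff.2 ((cls_eq_iff.1 h).smul _)) q

lemma res_csmul_eq_cls {S' : Sch k} (a : S' ⟶ S) {q : F.contractedProduct.Sec S} (g : S ⟶ G.X)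
    {x : F.Pair S'} (hx : F.cls x = F.contractedProduct.res a q) :
    F.contractedProduct.res a (F.csmul q g) = F.cls (x.smul (a ≫ g)) :=
  map_descend F.clsHom F.contractedProduct.isSheaf _ _ _ q a x hx

variable (F) in
/-- The left action of `Γ` on the contracted product. -/
def cgsmul (σ : Γ) (q : F.contractedProduct.Sec S) : F.contractedProduct.Sec S :=
  descend F.clsHom F.contractedProduct.isSheaf (fun _ _ x => F.cls (x.gsmul σ))
    (fun _ _ c _ x => (res_cls c _).trans (congrArg F.cls (Pair.res_gsmul c σ x)))
    (fun _ _ _ _ h => cls_eq_iff.2 ((cls_eq_iff.1 h).gsmul σ)) q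

lemma res_cgsmul_eq_cls {S' : Sch k} (a : S' ⟶ S) (σ : Γ) {q : F.contractedProduct.Sec S}
    {x : F.Pair S'} (hx : F.cls x = F.contractedProduct.res a q) :
    F.contractedProduct.res a (F.cgsmul σ q) = F.cls (x.gsmul σ) :=
  map_descend F.clsHom F.contractedProduct.isSheaf _ _ _ q a x hx

lemma cproj_cls (x : F.Pair S) : F.cproj (F.cls x) = x.proj := by
  rw [← comp_cproj (𝟙 S) (EtSheaf.res_id _ _).symm, Category.id_comp]

lemma csmul_cls (x : F.Pair S) (g : S ⟶ G.X) : F.csmul (F.cls x) g = F.cls (x.smul g) := by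
  rw [← EtSheaf.res_id _ (F.csmul _ g), res_csmul_eq_cls _ g (EtSheaf.res_id _ _).symm,
    Category.id_comp]

lemma cgsmul_cls (σ : Γ) (x : F.Pair S) : F.cgsmul σ (F.cls x) = F.cls (x.gsmul σ) := by
  rw [← EtSheaf.res_id _ (F.cgsmul σ _), res_cgsmul_eq_cls _ σ (EtSheaf.res_id _ _).symm]

section Res

variable {S' : Sch k} (a : S' ⟶ S) (q : F.contractedProduct.Sec S)

lemma cproj_res : F.cproj (F.contractedProduct.res a q) = a ≫ F.cproj q :=
  hom_ext (F.contractedProduct.res a q) fun S'' b x hx => by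
    rw [comp_cproj b hx, ← Category.assoc, comp_cproj (b ≫ a) (by rw [hx, EtSheaf.res_comp])]

lemma res_csmul (g : S ⟶ G.X) : F.contractedProduct.res a (F.csmul q g) =
    F.csmul (F.contractedProduct.res a q) (a ≫ g) :=
  sec_ext (F.contractedProduct.res a q) fun S'' b x hx => by
    rw [res_csmul_eq_cls b _ hx, ← EtSheaf.res_comp,
      res_csmul_eq_cls (b ≫ a) g (by rw [hx, EtSheaf.res_comp]), Category.assoc]

lemma res_cgsmul (σ : Γ) : F.contractedProduct.res a (F.cgsmul σ q) =
    F.cgsmul σ (F.contractedProduct.res a q) :=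
  sec_ext (F.contractedProduct.res a q) fun S'' b x hx => by
    rw [res_cgsmul_eq_cls b σ hx, ← EtSheaf.res_comp,
      res_cgsmul_eq_cls (b ≫ a) σ (by rw [hx, EtSheaf.res_comp])]

end Res

lemma Pair.eq_of_cls_eq {x y : F.Pair S} (hf : x.1.1 = y.1.1) (h : F.cls x = F.cls y) : x = y :=
  (cls_eq_iff.1 h).eq_of_left_eq hf

lemma exists_cover_forall_exists_cls_eq (f : F.sheaf.Sec S) (q : F.contractedProduct.Sec S)
    (hq : F.cproj q ≫ C.map ▷ T = F.proj f) : ∃ R ∈ etaleSite k S,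
      ∀ ⦃S' : Sch k⦄ (a : S' ⟶ S), R.arrows a → ∃ x : F.Pair S', x.1.1 = F.sheaf.res a f ∧
        F.cls x = F.contractedProduct.res a q := by
  refine ⟨_, Presheaf.imageSieve_mem (etaleSite k) F.clsHom q, fun S' a ⟨(x : F.Pair S'), hx⟩ => ?_⟩
  obtain ⟨y, hxy, hy⟩ := exists_rel_left_eq x (F.sheaf.res a f) (by
    rw [← Pair.proj_whiskerRight_map, ← comp_cproj a hx, Category.assoc, hq, F.proj_res])
  exact ⟨y, hy, (cls_eq_iff.2 hxy).symm.trans hx⟩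

lemma exists_cls_eq (f : F.sheaf.Sec S) (q : F.contractedProduct.Sec S)
    (hq : F.cproj q ≫ C.map ▷ T = F.proj f) : ∃ x : F.Pair S, x.1.1 = f ∧ F.cls x = q := by
  obtain ⟨R, hR, h_local⟩ := exists_cover_forall_exists_cls_eq f q hq
  obtain ⟨p, hp⟩ := exists_amalgamation P.sheaf.isSheaf
    (fun S' a z => ∃ x : F.Pair S', x.1.1 = F.sheaf.res a f ∧
      F.cls x = F.contractedProduct.res a q ∧ x.1.2 = z)
    (by
      rintro S' S'' b a _ ⟨x, hx, hxq, rfl⟩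
      refine ⟨x.res b, ?_, ?_, rfl⟩
      · exact (congrArg (F.sheaf.res b) hx).trans (EtSheaf.res_comp _ _ _ _).symm
      · rw [← res_cls, hxq, EtSheaf.res_comp])
    (by
      rintro S' a _ _ ⟨x, hx, hxq, rfl⟩ ⟨x', hx', hxq', rfl⟩
      rw [Pair.eq_of_cls_eq (hx.trans hx'.symm) (hxq.trans hxq'.symm)])
    hR fun S' a ha => (h_local a ha).elim fun x hx => ⟨_, x, hx.1, hx.2, rfl⟩
  have h_res ⦃S' : Sch k⦄ (a : S' ⟶ S) (x : F.Pair S') (hx : x.1.1 = F.sheaf.res a f)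
      (hxq : F.cls x = F.contractedProduct.res a q) : P.sheaf.res a p = x.1.2 :=
    hp a _ ⟨x, hx, hxq, rfl⟩
  have e : F.proj f ≫ fst C.base T = P.proj p ≫ C.map := hom_ext_of_cover hR fun S' a ha => by
    obtain ⟨x, hx, hxq⟩ := h_local a ha
    rw [← Category.assoc, ← Category.assoc, ← F.proj_res, ← P.proj_res, h_res a x hx hxq, ← hx, x.2]
  refine ⟨F.pair f p e, rfl, F.contractedProduct.ext_of_cover hR fun S' a ha => ?_⟩
  obtain ⟨x, hx, hxq⟩ := h_local a ha
  rw [res_cls, ← hxq]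
  exact congrArg F.cls (Subtype.ext (Prod.ext hx.symm (h_res a x hx hxq)))

lemma csmul_left_cancel (q : F.contractedProduct.Sec S) {g g' : S ⟶ G.X}
    (h : F.csmul q g = F.csmul q g') : g = g' :=
  hom_ext q fun S' a x hx => Rel.smul_left_cancel <| cls_eq_iff.1 <| by
    rw [← res_csmul_eq_cls a g hx, ← res_csmul_eq_cls a g' hx, h]

lemma exists_csmul_eq_of_section (f : F.sheaf.Sec S) {q q' : F.contractedProduct.Sec S}
    (h : F.cproj q = F.cproj q') (hq : F.cproj q ≫ C.map ▷ T = F.proj f) :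
    ∃ g, F.csmul q g = q' := by
  obtain ⟨x, hx, rfl⟩ := exists_cls_eq f q hq
  obtain ⟨x', hx', rfl⟩ := exists_cls_eq f q' (h ▸ hq)
  have h_proj : P.proj x.1.2 = P.proj x'.1.2 := by
    simpa only [cproj_cls, Pair.proj, lift_fst] using congrArg (· ≫ fst C.total T) h
  obtain ⟨g, hg, -⟩ := P.simply_transitive x.1.2 x'.1.2 h_proj
  exact ⟨g, (csmul_cls x g).trans
    (congrArg F.cls (Subtype.ext (Prod.ext (hx.trans hx'.symm) hg)))⟩

lemma exists_csmul_eq (q q' : F.contractedProduct.Sec S) (h : F.cproj q = F.cproj q') :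
    ∃ g, F.csmul q g = q' := by
  obtain ⟨R, hR, hF⟩ := F.locally_nonempty (F.cproj q ≫ C.map ▷ T)
  have h_local ⦃S' : Sch k⦄ (a : S' ⟶ S) (ha : R.arrows a) :
      ∃ g, F.csmul (F.contractedProduct.res a q) g = F.contractedProduct.res a q' := by
    obtain ⟨f, hf⟩ := hF a ha
    exact exists_csmul_eq_of_section f (by rw [cproj_res, cproj_res, h])
      (by rw [cproj_res, Category.assoc, hf])
  obtain ⟨g, hg⟩ := exists_amalgamation (isSheaf_yoneda G.X)
    (fun S' a g => F.csmul (F.contractedProduct.res a q) g = F.contractedProduct.res a q')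
    (fun S' S'' b a g hg => by
      rw [EtSheaf.res_comp, EtSheaf.res_comp, ← hg, res_csmul]
      rfl)
    (fun S' a g g' hg hg' => csmul_left_cancel _ (hg.trans hg'.symm)) hR h_local
  refine ⟨g, F.contractedProduct.ext_of_cover hR fun S' a ha => ?_⟩
  obtain ⟨g', hg'⟩ := h_local a ha
  rw [res_csmul, ← hg']
  exact congrArg _ (hg a g' hg')

variable (F) in
lemma locally_nonempty_contractedProduct (y : S ⟶ C.total ⊗ T) : ∃ R ∈ etaleSite k S,
    ∀ ⦃S' : Sch k⦄ (a : S' ⟶ S), R.arrows a →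
      ∃ q : F.contractedProduct.Sec S', F.cproj q = a ≫ y := by
  obtain ⟨R, hR, hF⟩ := F.locally_nonempty (y ≫ C.map ▷ T)
  obtain ⟨R', hR', hP⟩ := P.locally_nonempty (y ≫ fst C.total T)
  refine ⟨_, (etaleSite k).intersection_covering hR hR', fun S' a ha => ?_⟩
  obtain ⟨f, hf⟩ := hF a ha.1
  obtain ⟨p, hp⟩ := hP a ha.2
  have e : F.proj f ≫ fst C.base T = P.proj p ≫ C.map := by
    simp only [hf, hp, Category.assoc, whiskerRight_fst]
  exact ⟨F.cls (F.pair f p e), (cproj_cls _).trans <|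
    Pair.proj_eq (hf.trans (Category.assoc _ _ _).symm) (hp.trans (Category.assoc _ _ _).symm)⟩

variable (F) in
/-- The contracted product as a `(Γ, G)`-bundle on `X̃ × T`. -/
def contractedBundle : GBundle ρ (C.prod T) where
  sheaf := F.contractedProduct
  proj := F.cproj
  proj_res := cproj_res
  smul := F.csmul
  smul_one q := sec_ext q fun S' a x hx => by
    rw [res_csmul_eq_cls a 1 hx, MonObj.comp_one, Pair.smul_one, hx]
  smul_mul q g g' := sec_ext q fun S' a x hx => by
    rw [res_csmul_eq_cls a _ hx, MonObj.comp_mul, Pair.smul_mul,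
      res_csmul_eq_cls a g' (res_csmul_eq_cls a g hx).symm]
  smul_res := res_csmul
  proj_smul q g := hom_ext q fun S' a x hx =>
    (comp_cproj a (res_csmul_eq_cls a g hx).symm).trans
      ((Pair.proj_smul x _).trans (comp_cproj a hx).symm)
  simply_transitive q q' h := by
    obtain ⟨g, hg⟩ := exists_csmul_eq q q' h
    exact ⟨g, hg, fun g' hg' => csmul_left_cancel q (hg'.trans hg.symm)⟩
  locally_nonempty := F.locally_nonempty_contractedProduct
  gsmul := F.cgsmul
  gsmul_one q := sec_ext q fun S' a x hx => by
    rw [res_cgsmul_eq_cls a 1 hx, Pair.gsmul_one, hx]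
  gsmul_mul σ τ q := sec_ext q fun S' a x hx => by
    rw [res_cgsmul_eq_cls a _ hx, Pair.gsmul_mul,
      res_cgsmul_eq_cls a σ (res_cgsmul_eq_cls a τ hx).symm]
  gsmul_res a σ q := res_cgsmul a q σ
  proj_gsmul σ q := hom_ext q fun S' a x hx => by
    refine (comp_cproj a (res_cgsmul_eq_cls a σ hx).symm).trans ?_
    rw [Pair.proj_gsmul, ← comp_cproj a hx]
    exact Category.assoc _ _ _
  gsmul_smul σ q g := sec_ext q fun S' a x hx => by
    rw [res_cgsmul_eq_cls a σ (res_csmul_eq_cls a g hx).symm, Pair.gsmul_smul,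
      res_csmul_eq_cls a _ (res_cgsmul_eq_cls a σ hx).symm, Category.assoc]

end ContractedProduct

section LocalType

variable {y : S ⟶ C.total ⊗ T}

lemma proj_fst_of_fib_prod (q : (P.prod T).Fib y) : P.proj q.1.1 = y ≫ fst C.total T :=
  (lift_fst _ _).symm.trans (congrArg (· ≫ fst C.total T) q.2)

lemma fib_prod_ext {q q' : (P.prod T).Fib y} (h : q.1.1 = q'.1.1) : q = q' := by
  have h_snd (q : (P.prod T).Fib y) : q.1.2 = y ≫ snd C.total T :=
    (lift_snd _ _).symm.trans (congrArg (· ≫ snd C.total T) q.2)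
  exact Subtype.ext (Prod.ext h ((h_snd q).trans (h_snd q').symm))

/-- The pair `(f, p)`, for a point `(p, t)` of a fibre of `P × T`. -/
def pairOfFib (f : F.sheaf.Sec S) (hf : F.proj f = y ≫ C.map ▷ T) (q : (P.prod T).Fib y) :
    F.Pair S :=
  F.pair f q.1.1 (by
    rw [hf, proj_fst_of_fib_prod, Category.assoc, Category.assoc, whiskerRight_fst])

/-- The map `p ↦ [f, p]` from a fibre of `P × T` to a fibre of the contracted product. -/
def fibMap (f : F.sheaf.Sec S) (hf : F.proj f = y ≫ C.map ▷ T) (q : (P.prod T).Fib y) :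
    F.contractedBundle.Fib y :=
  ⟨F.cls (pairOfFib f hf q), (cproj_cls _).trans (Pair.proj_eq hf (proj_fst_of_fib_prod q))⟩

lemma fibMap_bijective (f : F.sheaf.Sec S) (hf : F.proj f = y ≫ C.map ▷ T) :
    Function.Bijective (fibMap f hf) := by
  refine ⟨fun q q' h => fib_prod_ext ?_, fun ⟨q, (hq : F.cproj q = y)⟩ => ?_⟩
  · exact congrArg (fun x : F.Pair S => x.1.2)
      (Pair.eq_of_cls_eq (x := pairOfFib f hf q) (y := pairOfFib f hf q') rfl
        (congrArg Subtype.val h))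
  · obtain ⟨x, hx, rfl⟩ := exists_cls_eq f q (by rw [hq, hf])
    have hp : lift (P.proj x.1.2) (y ≫ snd C.total T) = y := by
      rw [← hq, cproj_cls, Pair.proj, lift_snd]
    exact ⟨⟨(x.1.2, y ≫ snd C.total T), hp⟩,
      Subtype.ext (congrArg F.cls (Subtype.ext (Prod.ext hx.symm rfl)))⟩

lemma sameLocalTypeAt_proj (f : F.sheaf.Sec S) :
    SameLocalTypeAt (P.prod T) F.contractedBundle (F.proj f) :=
  ⟨{ toEquiv := fun a y h => Equiv.ofBijective _
        (fibMap_bijective (F.sheaf.res a f) ((F.proj_res a f).trans h))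
     natural := fun b a y h h' p => Subtype.ext <| by
        refine Eq.trans ?_ (res_cls b (pairOfFib _ ((F.proj_res a f).trans h) p)).symm
        exact congrArg F.cls (Subtype.ext (Prod.ext (EtSheaf.res_comp _ _ _ _) rfl))
     equivariant := fun a y h p g => Subtype.ext
        (csmul_cls (pairOfFib _ ((F.proj_res a f).trans h) p) g).symm },
    fun σ S' a y h h' p => Subtype.ext
      (cgsmul_cls σ (pairOfFib _ ((F.proj_res a f).trans h) p)).symm⟩

variable (F) in
lemma sameLocalType_contractedBundle : SameLocalType (P.prod T) F.contractedBundle := by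
  intro Ω _ _ x
  obtain ⟨R, hR, hF⟩ := F.locally_nonempty
    (Over.homMk (U := Over.mk (x ≫ (C.prod T).base.hom)) (V := (C.prod T).base) x)
  obtain ⟨f, hf⟩ := hF _ (id_mem_of_mem_over_etaleTopology _ hR)
  exact hf.trans (Category.id_comp _) ▸ sameLocalTypeAt_proj f

end LocalType

lemma contractedProduct_hom_ext {E : EtSheaf k} {u u' : F.contractedProduct ⟶ E}
    (h : ∀ {S : Sch k} (x : F.Pair S), EtSheaf.ap u (F.cls x) = EtSheaf.ap u' (F.cls x)) :
    u = u' := by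
  apply Sheaf.hom_ext
  ext S q
  exact sec_ext (e := EtSheaf.ap u q) (e' := EtSheaf.ap u' q) q fun S' a x hx => by
    rw [← EtSheaf.ap_res, ← EtSheaf.ap_res, ← hx, h]

end HBundle

namespace BunH

variable {P : GBundle ρ C}

section Hom

variable {F F' : BunH P} (u : Hom F F') {S : Sch k}

lemma Hom.pairMap_rel {x y : F.bundle.Pair S} (hxy : F.bundle.Rel x y) :
    F'.bundle.Rel (u.pairMap x) (u.pairMap y) := by
  obtain ⟨s, h, e, e', h_act, h_smul⟩ := HBundle.rel_iff.1 hxy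
  have e_map : F'.bundle.proj (EtSheaf.ap u.map y.1.1) ≫ fst C.base F'.T = s := by
    rw [u.proj_map, Category.assoc, whiskerLeft_fst, e]
  exact HBundle.rel_iff.2 ⟨s, h, e_map, e',
    (u.map_act _ h e e_map).symm.trans (congrArg (EtSheaf.ap u.map) h_act), h_smul⟩

lemma Hom.res_pairMap {S' : Sch k} (a : S' ⟶ S) (x : F.bundle.Pair S) :
    (u.pairMap x).res a = u.pairMap (x.res a) :=
  Subtype.ext (Prod.ext (EtSheaf.ap_res u.map a x.1.1).symm rfl)

lemma Hom.proj_pairMap (x : F.bundle.Pair S) :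
    (u.pairMap x).proj = x.proj ≫ C.total ◁ u.base := by
  rw [HBundle.Pair.proj, HBundle.Pair.proj, lift_whiskerLeft, Category.assoc,
    ← whiskerLeft_snd C.base u.base, ← Category.assoc, ← u.proj_map]
  rfl

/-- The morphism of presheaf quotients `(f, p) ↦ (u f, p)`. -/
def Hom.quotientMap : F.bundle.quotientPresheaf ⟶ F'.bundle.quotientPresheaf where
  app S := ↾(Quot.map u.pairMap fun _ _ h => u.pairMap_rel h)
  naturality S S' a := by
    ext ⟨x⟩
    exact congrArg (Quot.mk _) (u.res_pairMap a.unop x).symm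

/-- The morphism of contracted products `[f, p] ↦ [u f, p]`. -/
def Hom.contractedMap : F.bundle.contractedProduct ⟶ F'.bundle.contractedProduct :=
  (presheafToSheaf (etaleSite k) _).map u.quotientMap

lemma Hom.contractedMap_cls (x : F.bundle.Pair S) :
    EtSheaf.ap u.contractedMap (F.bundle.cls x) = F'.bundle.cls (u.pairMap x) :=
  congrArg (fun w => w.app (op S) (Quot.mk _ x))
    (toSheafify_naturality (etaleSite k) u.quotientMap).symm

lemma Hom.cls_pairMap {S' : Sch k} {a : S' ⟶ S} {q : F.bundle.contractedProduct.Sec S}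
    {x : F.bundle.Pair S'} (hx : F.bundle.cls x = F.bundle.contractedProduct.res a q) :
    F'.bundle.cls (u.pairMap x) =
      F'.bundle.contractedProduct.res a (EtSheaf.ap u.contractedMap q) := by
  rw [← EtSheaf.ap_res, ← hx, u.contractedMap_cls]

variable (q : F.bundle.contractedProduct.Sec S)

lemma Hom.cproj_contractedMap :
    F'.bundle.cproj (EtSheaf.ap u.contractedMap q) = F.bundle.cproj q ≫ C.total ◁ u.base :=
  HBundle.hom_ext q fun S' a x hx => by
    rw [HBundle.comp_cproj a (u.cls_pairMap hx), u.proj_pairMap, ← HBundle.comp_cproj a hx,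
      Category.assoc]

lemma Hom.contractedMap_csmul (g : S ⟶ G.X) : EtSheaf.ap u.contractedMap (F.bundle.csmul q g) =
    F'.bundle.csmul (EtSheaf.ap u.contractedMap q) g :=
  HBundle.sec_ext q fun S' a x hx => by
    rw [HBundle.res_csmul_eq_cls a g (u.cls_pairMap hx), ← u.cls_pairMap
      (HBundle.res_csmul_eq_cls a g hx).symm]
    rfl

lemma Hom.contractedMap_cgsmul (σ : Γ) : EtSheaf.ap u.contractedMap (F.bundle.cgsmul σ q) =
    F'.bundle.cgsmul σ (EtSheaf.ap u.contractedMap q) :=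
  HBundle.sec_ext q fun S' a x hx => by
    rw [HBundle.res_cgsmul_eq_cls a σ (u.cls_pairMap hx), ← u.cls_pairMap
      (HBundle.res_cgsmul_eq_cls a σ hx).symm]
    rfl

end Hom

/-- The contracted product of an `H_P`-bundle with `P`, as an object of `Bun^P_{(Γ,G)}`. -/
def toBunG (F : BunH P) : BunG P where
  T := F.T
  bundle := F.bundle.contractedBundle
  sameLocalType := F.bundle.sameLocalType_contractedBundle

/-- The morphism `[f, p] ↦ [u f, p]` of `Bun^P_{(Γ,G)}`. -/
def Hom.toBunG {F F' : BunH P} (u : Hom F F') : F.toBunG ⟶ F'.toBunG where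
  base := u.base
  map := u.contractedMap
  proj_map := u.cproj_contractedMap
  map_smul := u.contractedMap_csmul
  map_gsmul σ q := u.contractedMap_cgsmul q σ

lemma isContractedProduct_toBunG (F : BunH P) :
    IsContractedProduct F F.toBunG rfl (Iso.refl _) where
  proj_total x := (congrArg (· ≫ fst C.total F.T) (HBundle.cproj_cls x)).trans (lift_fst _ _)
  proj_T x := (congrArg (· ≫ snd C.total F.T ≫ 𝟙 F.T) (HBundle.cproj_cls x)).trans <|
    (congrArg (x.proj ≫ ·) (Category.comp_id _)).trans (lift_snd _ _)
  smul := HBundle.csmul_cls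
  gsmul := HBundle.cgsmul_cls

end BunH

/-- The morphism of stacks `F ↦ π^* F ×^{π^* H_P} P`, as a functor over the category of
`k`-schemes. -/
def contractedProductFunctor (P : GBundle ρ C) : BasedFunctor (bunH P) (bunG P) where
  obj := BunH.toBunG
  map := BunH.Hom.toBunG
  map_id F := BunG.Hom.ext rfl <|
    HBundle.contractedProduct_hom_ext fun x => BunH.Hom.contractedMap_cls (𝟙 F) x
  map_comp u v := BunG.Hom.ext rfl <| HBundle.contractedProduct_hom_ext fun x =>
    (BunH.Hom.contractedMap_cls (u ≫ v) x).trans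
      ((congrArg _ (BunH.Hom.contractedMap_cls u x)).trans
        (BunH.Hom.contractedMap_cls v _)).symm
  w := rfl

namespace BunG

variable {P : GBundle ρ C} {Q Q' Q'' : BunG P} {S : Sch k} (u : Hom Q Q')

include u in
lemma Hom.eq_of_proj_eq {q₁ q₂ : Q.bundle.sheaf.Sec S} (h : Q.bundle.proj q₁ = Q.bundle.proj q₂)
    (h_map : EtSheaf.ap u.map q₁ = EtSheaf.ap u.map q₂) : q₁ = q₂ := by
  obtain ⟨g, rfl, -⟩ := Q.bundle.simply_transitive q₁ q₂ h
  rw [u.map_smul] at h_map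
  rw [← Q'.bundle.smul_left_cancel _ ((Q'.bundle.smul_one _).trans h_map), Q.bundle.smul_one]

section Lift

variable (y : S ⟶ C.total ⊗ Q.T) (q' : Q'.bundle.sheaf.Sec S)
  (hq' : Q'.bundle.proj q' = y ≫ C.total ◁ u.base)
include hq'

lemma Hom.exists_lift_of_section (p : Q.bundle.sheaf.Sec S) (hp : Q.bundle.proj p = y) :
    ∃ q : Q.bundle.sheaf.Sec S, Q.bundle.proj q = y ∧ EtSheaf.ap u.map q = q' := by
  obtain ⟨g, hg, -⟩ := Q'.bundle.simply_transitive (EtSheaf.ap u.map p) q'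
    (by rw [u.proj_map, hp]; exact hq'.symm)
  exact ⟨Q.bundle.smul p g, (Q.bundle.proj_smul p g).trans hp, (u.map_smul p g).trans hg⟩

lemma Hom.exists_lift :
    ∃ q : Q.bundle.sheaf.Sec S, Q.bundle.proj q = y ∧ EtSheaf.ap u.map q = q' := by
  obtain ⟨R, hR, h_sec⟩ := Q.bundle.locally_nonempty y
  have h_lift ⦃S' : Sch k⦄ (a : S' ⟶ S) (ha : R.arrows a) : ∃ q : Q.bundle.sheaf.Sec S',
      Q.bundle.proj q = a ≫ y ∧ EtSheaf.ap u.map q = Q'.bundle.sheaf.res a q' := by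
    obtain ⟨p, hp⟩ := h_sec a ha
    refine u.exists_lift_of_section _ _ ?_ p hp
    rw [Q'.bundle.proj_res, hq']
    exact (Category.assoc _ _ _).symm
  obtain ⟨q, hq⟩ := exists_amalgamation Q.bundle.sheaf.isSheaf
    (fun S' a q => Q.bundle.proj q = a ≫ y ∧ EtSheaf.ap u.map q = Q'.bundle.sheaf.res a q')
    (fun S' S'' b a q ⟨hq, hqu⟩ =>
      ⟨(Q.bundle.proj_res b q).trans ((congrArg (b ≫ ·) hq).trans (Category.assoc _ _ _).symm),
        (EtSheaf.ap_res u.map b q).trans ((congrArg _ hqu).trans (EtSheaf.res_comp _ _ _ _).symm)⟩)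
    (fun S' a q₁ q₂ h₁ h₂ =>
      u.eq_of_proj_eq (h₁.1.trans h₂.1.symm) (h₁.2.trans h₂.2.symm))
    hR h_lift
  have res_q ⦃S' : Sch k⦄ (a : S' ⟶ S) (ha : R.arrows a) :
      Q.bundle.proj (Q.bundle.sheaf.res a q) = a ≫ y ∧
        EtSheaf.ap u.map (Q.bundle.sheaf.res a q) = Q'.bundle.sheaf.res a q' := by
    obtain ⟨q₁, hq₁⟩ := h_lift a ha
    rwa [← (hq a q₁ hq₁ : Q.bundle.sheaf.res a q = q₁)] at hq₁
  exact ⟨q, hom_ext_of_cover hR fun S' a ha =>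
      (Q.bundle.proj_res a q).symm.trans (res_q a ha).1,
    Q'.bundle.sheaf.ext_of_cover hR fun S' a ha =>
      (EtSheaf.ap_res u.map a q).symm.trans (res_q a ha).2⟩

end Lift

section Factorization

variable (v : Hom Q'' Q') (g : Q''.T ⟶ Q.T) (hg : v.base = g ≫ u.base)
include hg

lemma Hom.exists_lift_comp (q : Q''.bundle.sheaf.Sec S) : ∃ q₁ : Q.bundle.sheaf.Sec S,
    Q.bundle.proj q₁ = Q''.bundle.proj q ≫ C.total ◁ g ∧
      EtSheaf.ap u.map q₁ = EtSheaf.ap v.map q := by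
  refine u.exists_lift (Q''.bundle.proj q ≫ C.total ◁ g) _ ?_
  rw [v.proj_map, hg, MonoidalCategory.whiskerLeft_comp]
  exact (Category.assoc _ _ _).symm

/-- The factorization of `v` through `u` over `g`, on sections: the point over the image of `q` in
`X̃ × T` which `u` maps to the image of `q` under `v`. -/
def Hom.factorSec (q : Q''.bundle.sheaf.Sec S) : Q.bundle.sheaf.Sec S :=
  (u.exists_lift_comp v g hg q).choose

lemma Hom.proj_factorSec (q : Q''.bundle.sheaf.Sec S) :
    Q.bundle.proj (u.factorSec v g hg q) = Q''.bundle.proj q ≫ C.total ◁ g :=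
  (u.exists_lift_comp v g hg q).choose_spec.1

lemma Hom.ap_factorSec (q : Q''.bundle.sheaf.Sec S) :
    EtSheaf.ap u.map (u.factorSec v g hg q) = EtSheaf.ap v.map q :=
  (u.exists_lift_comp v g hg q).choose_spec.2

lemma Hom.eq_factorSec {q : Q''.bundle.sheaf.Sec S} {q₁ : Q.bundle.sheaf.Sec S}
    (h : Q.bundle.proj q₁ = Q''.bundle.proj q ≫ C.total ◁ g)
    (h_map : EtSheaf.ap u.map q₁ = EtSheaf.ap v.map q) : q₁ = u.factorSec v g hg q :=
  u.eq_of_proj_eq (h.trans (u.proj_factorSec v g hg q).symm)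
    (h_map.trans (u.ap_factorSec v g hg q).symm)

lemma Hom.res_factorSec {S' : Sch k} (a : S' ⟶ S) (q : Q''.bundle.sheaf.Sec S) :
    Q.bundle.sheaf.res a (u.factorSec v g hg q) =
      u.factorSec v g hg (Q''.bundle.sheaf.res a q) := by
  refine u.eq_factorSec v g hg ?_ ?_
  · rw [Q.bundle.proj_res, u.proj_factorSec, Q''.bundle.proj_res]
    exact (Category.assoc _ _ _).symm
  · rw [EtSheaf.ap_res, u.ap_factorSec, EtSheaf.ap_res]

lemma Hom.smul_factorSec (q : Q''.bundle.sheaf.Sec S) (c : S ⟶ G.X) :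
    Q.bundle.smul (u.factorSec v g hg q) c = u.factorSec v g hg (Q''.bundle.smul q c) := by
  refine u.eq_factorSec v g hg ?_ ?_
  · rw [Q.bundle.proj_smul, u.proj_factorSec, Q''.bundle.proj_smul]
  · rw [u.map_smul, u.ap_factorSec, v.map_smul]

lemma Hom.gsmul_factorSec (σ : Γ) (q : Q''.bundle.sheaf.Sec S) :
    Q.bundle.gsmul σ (u.factorSec v g hg q) = u.factorSec v g hg (Q''.bundle.gsmul σ q) := by
  refine u.eq_factorSec v g hg ?_ ?_
  · rw [Q.bundle.proj_gsmul, u.proj_factorSec, Q''.bundle.proj_gsmul]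
    calc (Q''.bundle.proj q ≫ C.total ◁ g) ≫ (C.act σ).hom ▷ Q.T
        = Q''.bundle.proj q ≫ C.total ◁ g ≫ (C.act σ).hom ▷ Q.T := Category.assoc _ _ _
      _ = Q''.bundle.proj q ≫ (C.act σ).hom ▷ Q''.T ≫ C.total ◁ g :=
        congrArg _ (whisker_exchange _ _)
      _ = (Q''.bundle.proj q ≫ (C.act σ).hom ▷ Q''.T) ≫ C.total ◁ g :=
        (Category.assoc _ _ _).symm
  · rw [u.map_gsmul, u.ap_factorSec, v.map_gsmul]

/-- The factorization of a morphism `v` through `u`, over a factorization `g` of its base. -/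
def Hom.factor : Hom Q'' Q where
  base := g
  map := ⟨{ app := fun S => ↾(u.factorSec v g hg)
            naturality := fun S S' a => by
              ext q
              exact (u.res_factorSec v g hg a.unop q).symm }⟩
  proj_map := u.proj_factorSec v g hg
  map_smul q c := (u.smul_factorSec v g hg q c).symm
  map_gsmul σ q := (u.gsmul_factorSec v g hg σ q).symm

end Factorization

lemma Hom.ext_ap {w w' : Hom Q Q'} (h_base : w.base = w'.base)
    (h : ∀ {S : Sch k} (q : Q.bundle.sheaf.Sec S), EtSheaf.ap w.map q = EtSheaf.ap w'.map q) :
    w = w' := by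
  refine Hom.ext h_base (Sheaf.hom_ext ?_)
  ext S q
  exact h q

lemma Hom.existsUnique_comp_eq (u : Q ⟶ Q') (v : Q'' ⟶ Q') (g : Q''.T ⟶ Q.T)
    (hg : Hom.base v = g ≫ Hom.base u) : ∃! w : Q'' ⟶ Q, Hom.base w = g ∧ w ≫ u = v := by
  refine ⟨Hom.factor u v g hg, ⟨rfl, Hom.ext_ap hg.symm fun q => ?_⟩, ?_⟩
  · exact Hom.ap_factorSec u v g hg q
  · rintro w ⟨rfl, rfl⟩
    exact Hom.ext_ap rfl fun q => Hom.eq_factorSec u _ _ hg (Hom.proj_map w q) rfl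

lemma isStronglyCartesian {Q Q' : (bunG P).obj} (u : Q ⟶ Q') :
    (bunG P).p.IsStronglyCartesian ((bunG P).p.map u) u where
  universal_property' {Q''} g v hv := by
    have hg := IsHomLift.eq_of_isHomLift (bunG P).p (g ≫ (bunG P).p.map u) v
    obtain ⟨w, ⟨rfl, hw⟩, hw_unique⟩ := Hom.existsUnique_comp_eq u v g hg.symm
    exact ⟨w, ⟨IsHomLift.map (p := (bunG P).p) w, hw⟩, fun w' ⟨hw'_lift, hw'⟩ =>
      hw_unique w' ⟨(IsHomLift.eq_of_isHomLift (bunG P).p _ w').symm, hw'⟩⟩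

end BunG
end Bundles
end GammaBundle
end

theorem proposition3p1_general {k : Type u} [Field k] {Γ : Type v} [Group Γ]
    {G : Grp (GammaBundle.Sch k)} (ρ : Γ →* Aut G) (C : GammaBundle.EquivMap k Γ)
    (P : GammaBundle.GBundle ρ C) :
    ∃ (Φ : BasedFunctor (GammaBundle.bunH P) (GammaBundle.bunG P))
      (e : ∀ F : GammaBundle.BunH P,
        F.bundle.contractedProduct ≅ (GammaBundle.BunG.bundle (Φ.obj F)).sheaf),
      (∀ F : GammaBundle.BunH P,
        GammaBundle.IsContractedProduct F (Φ.obj F) (Φ.w_obj F) (e F)) ∧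
      (∀ (F F' : GammaBundle.BunH P) (u : F ⟶ F') (S : GammaBundle.Sch k)
        (x : F.bundle.Pair S),
        GammaBundle.EtSheaf.ap (GammaBundle.BunG.Hom.map (Φ.map u))
            (GammaBundle.EtSheaf.ap (e F).hom (F.bundle.cls x)) =
          GammaBundle.EtSheaf.ap (e F').hom
            (F'.bundle.cls (GammaBundle.BunH.Hom.pairMap u x))) ∧
      (∀ (F F' : (GammaBundle.bunH P).obj) (u : F ⟶ F'),
        (GammaBundle.bunG P).p.IsStronglyCartesian
          ((GammaBundle.bunG P).p.map (Φ.map u)) (Φ.map u)) :=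
  ⟨GammaBundle.contractedProductFunctor P, fun _ => Iso.refl _,
    GammaBundle.BunH.isContractedProduct_toBunG,
    fun _ _ u _ x => GammaBundle.BunH.Hom.contractedMap_cls u x,
    fun _ _ _ => GammaBundle.BunG.isStronglyCartesian _⟩

theorem proposition3p1 {k : Type u} [Field k] {Γ : Type v} [Group Γ] [Finite Γ]
    (hΓ : ((Nat.card Γ : ℕ) : k) ≠ 0)
    (G : Grp (GammaBundle.Sch k)) [IsAffineHom G.X.hom] [LocallyOfFiniteType G.X.hom]
    (ρ : Γ →* Aut G)
    (C : GammaBundle.EquivMap k Γ) (hC : C.IsRamifiedCovering)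
    (P : GammaBundle.GBundle ρ C) :
    ∃ (Φ : BasedFunctor (GammaBundle.bunH P) (GammaBundle.bunG P))
      (e : ∀ F : GammaBundle.BunH P,
        F.bundle.contractedProduct ≅ (GammaBundle.BunG.bundle (Φ.obj F)).sheaf),
      (∀ F : GammaBundle.BunH P,
        GammaBundle.IsContractedProduct F (Φ.obj F) (Φ.w_obj F) (e F)) ∧
      (∀ (F F' : GammaBundle.BunH P) (u : F ⟶ F') (S : GammaBundle.Sch k)
        (x : F.bundle.Pair S),
        GammaBundle.EtSheaf.ap (GammaBundle.BunG.Hom.map (Φ.map u))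
            (GammaBundle.EtSheaf.ap (e F).hom (F.bundle.cls x)) =
          GammaBundle.EtSheaf.ap (e F').hom
            (F'.bundle.cls (GammaBundle.BunH.Hom.pairMap u x))) ∧
      (∀ (F F' : (GammaBundle.bunH P).obj) (u : F ⟶ F'),
        (GammaBundle.bunH P).p.IsStronglyCartesian ((GammaBundle.bunH P).p.map u) u →
        (GammaBundle.bunG P).p.IsStronglyCartesian
          ((GammaBundle.bunG P).p.map (Φ.map u)) (Φ.map u)) := by
  obtain ⟨Φ, e, h_prod, h_map, h_cartesian⟩ := proposition3p1_general ρ C P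
  exact ⟨Φ, e, h_prod, h_map, fun F F' u _ => h_cartesian F F' u⟩
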